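/- Let $\Phi$ be a finite irreducible reduced crystallographic root system with simple roots $\alpha_i$ ($i\in I$), positive roots $\Phi^+$, highest root $\theta$, Weyl group $W$ with length function $\ell$, reflections $r_\beta$ ($\beta\in\Phi$), and Bruhat order with covering relation $\lessdot$. Let $J\subseteq I$ (for instance $J=\{i\in I\mid\langle\alpha_i^\vee,\lambda\rangle=0\}$ for a dominant weight $\lambda$), let $W_J$ be the subgroup generated by the $r_{\alpha_i}$, $i\in J$ (in the instance, the stabilizer of $\lambda$), let $\Phi_J=\Phi\cap\bigoplus_{i\in J}\mathbb Z\alpha_i$, $\Phi_J^+=\Phi_J\cap\Phi^+$, $\rho=\frac12\sum_{\beta\in\Phi^+}\beta$, $\rho_J=\frac12\sum_{\beta\in\Phi_J^+}\beta$. Let $W^J$ be the set of minimum-length representatives of the cosets in $W/W_J$, and let $\lfloor v\rfloor\in W^J$ denote the minimum-length element of $vW_J$. The parabolic quantum Bruhat graph $\mathrm{QB}(W^J)$ has vertex set $W^J$ and, for $w\in W^J$ and $\alpha\in\Phi^+\setminus\Phi_J^+$, an edge $w\xrightarrow{\alpha}\lfloor wr_\alpha\rfloor$ whenever one of the following holds: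 $w\lessdot wr_\alpha$ (a Bruhat edge), or $\ell(\lfloor wr_\alpha\rfloor)=\ell(w)+1-\langle\alpha^\vee,2\rho-2\rho_J\rangle$ (a quantum edge). Let $w\in W^J$ and $\gamma\in\Phi^+\setminus\Phi_J^+$. Write $v=\lfloor wr_\gamma\rfloor$. **(1)** Let $\alpha$ be a simple root. For a type $t\in\{\text{Bruhat},\text{quantum}\}$ consider * bottom edges: a Bruhat edge $w\xrightarrow{w^{-1}(\alpha)}r_\alpha w$ and an edge $w\xrightarrow{\gamma}v$ of type $t$; * top edges: an edge $r_\alpha w\xrightarrow{\gamma}r_\alpha v$ of type $t$ and a Bruhat edge $v\xrightarrow{v^{-1}(\alpha)}r_\alpha v$. If $t$ is Bruhat: when $\gamma\ne w^{-1}(\alpha)$, existence of the bottom two edges implies existence of the top two; when $\gamma\neq -w^{-1}(\alpha)$, existence of the top two edges implies existence of the bottom two. If $t$ is quantum: the bottom two edges exist if and only if the top two edges exist. For both types, whenever the top two edges exist, or the bottom two edges exist (with $\gamma\ne w^{-1}(\alpha)$ if $t$ is Bruhat), we have $r_\alpha\lfloor wr_\gamma\rfloor=\lfloor r_\alpha wr_\gamma\rfloor$.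 **(2)** Define $z\in W_J$ by $r_\theta w=\lfloor r_\theta w\rfloor z$. For types $t,t'$ consider * bottom edges: a quantum edge $w\xrightarrow{-w^{-1}(\theta)}\lfloor r_\theta w\rfloor$ and an edge $w\xrightarrow{\gamma}v$ of type $t$; * top edges: an edge $\lfloor r_\theta w\rfloor\xrightarrow{z(\gamma)}\lfloor r_\theta wr_\gamma\rfloor$ of type $t'$ and a quantum edge $v\xrightarrow{-v^{-1}(\theta)}\lfloor r_\theta wr_\gamma\rfloor$. Let $t$ be arbitrary, and let $t'$ be the opposite type to $t$ if $\langle w^{-1}(\theta),\gamma^\vee\rangle\ne0$, and $t'=t$ if $\langle w^{-1}(\theta),\gamma^\vee\rangle=0$. Then existence of the bottom two edges implies existence of the top two, where in the case that both bottom edges are quantum we assume $\gamma\neq-w^{-1}(\theta)$; and existence of the top two edges implies existence of the bottom two, where in the case that both top edges are quantum we assume $\gamma\ne w^{-1}(\theta)$. -/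

import Mathlib

noncomputable section

namespace PQBG

variable {ι K M N : Type*} [Field K] [AddCommGroup M] [Module K M]
  [AddCommGroup N] [Module K N] {P : RootPairing ι K M N}

/-- The reflection `r_β` in the root with index `β`, as an element of the Weyl group. -/
abbrev refl (P : RootPairing ι K M N) (β : ι) : P.weylGroup :=
  RootPairing.weylGroup.ofIdx P β

/-- The (index of the) root `w(β)`; see `PQBG.root_act`. -/
def act (w : P.weylGroup) (β : ι) : ι := P.weylGroupToPerm w β

theorem root_act (w : P.weylGroup) (β : ι) : P.root (act w β) = w • P.root β :=
  (P.weylGroup_apply_root w β).symm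

/-- The (index of the) root `-β`; see `PQBG.root_neg`. -/
def neg (P : RootPairing ι K M N) (β : ι) : ι := P.reflectionPerm β β

theorem root_neg (β : ι) : P.root (neg P β) = -P.root β := by
  simp [neg]

/-- The length `ℓ(w)`: the least number of factors in an expression of `w` as a product of
simple reflections. -/
def length (b : P.Base) (w : P.weylGroup) : ℕ :=
  sInf {n | ∃ l : List ι, (∀ i ∈ l, i ∈ b.support) ∧ (l.map (refl P)).prod = w ∧ l.length = n}

/-- The strict Bruhat order on the Weyl group: the transitive closure of the relation
`x < x r_β` whenever `ℓ(x) < ℓ(x r_β)`. -/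
def BruhatLT (b : P.Base) : P.weylGroup → P.weylGroup → Prop :=
  Relation.TransGen fun x y => ∃ β : ι, y = x * refl P β ∧ length b x < length b y

/-- The covering relation `x ⋖ y` of the Bruhat order. -/
def BruhatCovBy (b : P.Base) (x y : P.weylGroup) : Prop :=
  BruhatLT b x y ∧ ∀ u, BruhatLT b x u → ¬ BruhatLT b u y

/-- The parabolic subgroup `W_J` generated by the simple reflections `r_j`, `j ∈ J`. -/
def parabolic (P : RootPairing ι K M N) (J : Set ι) : Subgroup P.weylGroup :=
  Subgroup.closure (refl P '' J)

/-- The set `W^J` of those `w` that have minimum length in their coset `w W_J`. -/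
def minReps (b : P.Base) (J : Set ι) : Set P.weylGroup :=
  {w | ∀ u ∈ parabolic P J, length b w ≤ length b (w * u)}

/-- The coset `v W_J`. -/
def leftCoset (J : Set ι) (v : P.weylGroup) : Set P.weylGroup :=
  {x | v⁻¹ * x ∈ parabolic P J}

theorem leftCoset_nonempty (J : Set ι) (v : P.weylGroup) : (leftCoset J v).Nonempty :=
  ⟨v, by simp [leftCoset]⟩

/-- The minimum-length representative `⌊v⌋` of the coset `v W_J`. -/
def floorRep (b : P.Base) (J : Set ι) (v : P.weylGroup) : P.weylGroup :=
  Function.argminOn (length b) (leftCoset J v) (leftCoset_nonempty J v)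

theorem floorRep_mem (b : P.Base) (J : Set ι) (v : P.weylGroup) :
    v⁻¹ * floorRep b J v ∈ parabolic P J :=
  Function.argminOn_mem (length b) (leftCoset J v) (leftCoset_nonempty J v)

theorem length_floorRep_le (b : P.Base) (J : Set ι) (v x : P.weylGroup)
    (hx : v⁻¹ * x ∈ parabolic P J) : length b (floorRep b J v) ≤ length b x :=
  Function.argminOn_le (length b) (leftCoset J v) hx

variable [CharZero K]

/-- `Φ^+`. -/
def posRoots (b : P.Base) : Set ι := {β | b.IsPos β}

/-- `Φ_J = Φ ∩ ⨁_{j ∈ J} ℤ α_j`, the root subsystem of `W_J`. -/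
def parabolicRoots (P : RootPairing ι K M N) (J : Set ι) : Set ι :=
  {β | P.root β ∈ Submodule.span ℤ (P.root '' J)}

/-- `ρ_J`, half the sum of the positive roots in `Φ_J`. -/
def rhoPar (b : P.Base) (J : Set ι) : M :=
  (1 / 2 : K) • ∑ᶠ β ∈ posRoots b ∩ parabolicRoots P J, P.root β

/-- `ρ`, half the sum of the positive roots. -/
def rho (b : P.Base) : M :=
  (1 / 2 : K) • ∑ᶠ β ∈ posRoots b, P.root β

/-- The two types of edges: Bruhat and quantum. -/
inductive EdgeType
  | bruhat
  | quantum

/-- The length condition on an edge of the given type starting at `w` with label `α`. -/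
def EdgeCondition (b : P.Base) (J : Set ι) (w : P.weylGroup) (α : ι) : EdgeType → Prop
  | .bruhat => BruhatCovBy b w (w * refl P α)
  | .quantum =>
      (length b (floorRep b J (w * refl P α)) : K) =
        length b w + 1 - P.coroot' α ((2 : K) • rho b - (2 : K) • rhoPar b J)

/-- `Edge b J t w α v`: in the parabolic quantum Bruhat graph `QB(W^J)` there is an edge of type
`t` with label `α ∈ Φ^+ \ Φ_J^+` from `w ∈ W^J` to `v = ⌊w r_α⌋`. -/
structure Edge (b : P.Base) (J : Set ι) (t : EdgeType) (w : P.weylGroup) (α : ι)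
    (v : P.weylGroup) : Prop where
  source_mem : w ∈ minReps b J
  label_mem : α ∈ posRoots b \ parabolicRoots P J
  target_eq : v = floorRep b J (w * refl P α)
  condition : EdgeCondition b J w α t

/-- `θ` is the highest root: every `θ - β`, `β ∈ Φ`, is a sum of simple roots. -/
def IsHighestRoot (b : P.Base) (θ : ι) : Prop :=
  ∀ β : ι, P.root θ - P.root β ∈ AddSubmonoid.closure (P.root '' b.support)

/-- The bottom two edges `w → r_α w` (Bruhat) and `w → ⌊w r_γ⌋` (of type `t`) of the diamond for
the simple root `α`. -/
def SimpleBottom (b : P.Base) (J : Set ι) (w : P.weylGroup) (γ α : ι) (t : EdgeType) : Prop :=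
  Edge b J .bruhat w (act w⁻¹ α) (refl P α * w) ∧
  Edge b J t w γ (floorRep b J (w * refl P γ))

/-- The top two edges `r_α w → r_α ⌊w r_γ⌋` (of type `t`) and `⌊w r_γ⌋ → r_α ⌊w r_γ⌋` (Bruhat) of
the diamond for the simple root `α`. -/
def SimpleTop (b : P.Base) (J : Set ι) (w : P.weylGroup) (γ α : ι) (t : EdgeType) : Prop :=
  Edge b J t (refl P α * w) γ (refl P α * floorRep b J (w * refl P γ)) ∧
  Edge b J .bruhat (floorRep b J (w * refl P γ)) (act (floorRep b J (w * refl P γ))⁻¹ α)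
    (refl P α * floorRep b J (w * refl P γ))

/-- The bottom two edges `w → ⌊r_θ w⌋` (quantum) and `w → ⌊w r_γ⌋` (of type `t`) of the diamond
for the highest root `θ`. -/
def ThetaBottom (b : P.Base) (J : Set ι) (w : P.weylGroup) (γ θ : ι) (t : EdgeType) : Prop :=
  Edge b J .quantum w (neg P (act w⁻¹ θ)) (floorRep b J (refl P θ * w)) ∧
  Edge b J t w γ (floorRep b J (w * refl P γ))

/-- The top two edges `⌊r_θ w⌋ → ⌊r_θ w r_γ⌋` (with label `z(γ)`, of type `t`) and
`⌊w r_γ⌋ → ⌊r_θ w r_γ⌋` (quantum) of the diamond for the highest root `θ`. -/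
def ThetaTop (b : P.Base) (J : Set ι) (w : P.weylGroup) (γ θ : ι) (z : P.weylGroup)
    (t : EdgeType) : Prop :=
  Edge b J t (floorRep b J (refl P θ * w)) (act z γ)
    (floorRep b J (refl P θ * w * refl P γ)) ∧
  Edge b J .quantum (floorRep b J (w * refl P γ)) (neg P (act (floorRep b J (w * refl P γ))⁻¹ θ))
    (floorRep b J (refl P θ * w * refl P γ))

end PQBG

end

noncomputable section

namespace PQBG

open scoped Classical

set_option linter.unusedSectionVars false

variable {ι K M N : Type*} [Field K] [AddCommGroup M] [Module K M]
  [AddCommGroup N] [Module K N] {P : RootPairing ι K M N}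

/-! ### The Weyl group acting on root indices; reflections and pairings. -/

section Action

/-! Lengths in W^J are replaced by counts of inversions. Let `lenOff b J u` count the roots of Φ^+ \
Φ_J that u makes negative. It depends only on the coset u W_J and equals ℓ(⌊u⌋) (`length_floorRep`).
With c(γ) = ⟨γ^∨, 2ρ - 2ρ_J⟩ and t = 0 for Bruhat, t = 1 for quantum, both edge conditions become
one equation, `LenCond`: L(u r_γ) - L(u) = 1 - t c(γ), where L = `lenOff b J` (`edgeCondition_iff`).

For γ in Φ^+ \ Φ_J the difference on the left lies in [1, c(γ) - 1] if uγ > 0 and in [1 - c(γ), -1]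
if uγ < 0 (`lenOff_refl_of_pos`, `lenOff_refl_of_neg`). Edges are thus the extreme cases, and the
sign of uγ determines the type.

A simple root (χ = 0) and -θ, the finite part of the affine simple root (χ = 1), are treated alike.
Let α be such a root and η = u⁻¹α. Left multiplication by r_α changes L by sgn(η) - χ c(η), where
sgn records whether η is in Φ^+ \ Φ_J, in Φ_J, or the negative of the former
(`IsAffineSimple.lenOff_refl_mul`). If γ ≠ ±η, it changes the indicator of uγ < 0 by -χ⟨γ, η^∨⟩
(`ShiftsSigns`).

Comparing the first formula at u and at u r_γ expresses the length change along one horizontal side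
of the diamond through that along the other. Given one pair of edges, the change along the opposite
side is sgn - t' c(γ), with t' the indicator there and sgn the sign of the missing vertical label.
The bounds leave only sgn = 1, so the missing vertical edge and the missing horizontal edge, of type
t', appear together (`diamond_up`, `diamond_down`). Since t' - t is ±χ⟨γ, η^∨⟩ and both types are 0
or 1, the type changes exactly when χ times this pairing is nonzero. -/

theorem act_one (β : ι) : act (1 : P.weylGroup) β = β := by
  simp [act]

theorem act_mul (u v : P.weylGroup) (β : ι) : act (u * v) β = act u (act v β) := by
  simp only [act, map_mul]; rfl

theorem act_inv_act (u : P.weylGroup) (β : ι) : act u⁻¹ (act u β) = β := by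
  rw [← act_mul, inv_mul_cancel, act_one]

theorem act_act_inv (u : P.weylGroup) (β : ι) : act u (act u⁻¹ β) = β := by
  rw [← act_mul, mul_inv_cancel, act_one]

theorem act_refl (β γ : ι) : act (refl P β) γ = P.reflectionPerm β γ := rfl

theorem act_refl_refl (β γ : ι) : act (refl P β) (act (refl P β) γ) = γ := by
  simp [act_refl]

theorem act_refl_self (β : ι) : act (refl P β) β = neg P β := rfl

/-- The permutation of the roots induced by an element of the Weyl group. -/
def actPerm (u : P.weylGroup) : Equiv.Perm ι where
  toFun := act u
  invFun := act u⁻¹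
  left_inv := act_inv_act u
  right_inv := act_act_inv u

theorem act_injective (u : P.weylGroup) : Function.Injective (act u) :=
  (actPerm u).injective

theorem root_act_eq (u : P.weylGroup) (β : ι) : P.root (act u β) =
    RootPairing.Equiv.weightHom P u (P.root β) := root_act u β

theorem neg_neg (β : ι) : neg P (neg P β) = β := by
  apply P.root.injective; simp [root_neg]

theorem act_neg (u : P.weylGroup) (β : ι) : act u (neg P β) = neg P (act u β) := by
  apply P.root.injective; simp only [root_act_eq, root_neg, map_neg]

theorem refl_mul_self (β : ι) : refl P β * refl P β = 1 := by
  apply Subtype.ext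
  change RootPairing.Equiv.reflection P β * RootPairing.Equiv.reflection P β = 1
  rw [mul_eq_one_iff_inv_eq, RootPairing.Equiv.reflection_inv]

theorem refl_inv (β : ι) : (refl P β)⁻¹ = refl P β :=
  inv_eq_of_mul_eq_one_left (refl_mul_self β)

theorem mul_refl_refl (u : P.weylGroup) (β : ι) : u * refl P β * refl P β = u := by
  rw [mul_assoc, refl_mul_self, mul_one]

theorem refl_mul_refl_mul (u : P.weylGroup) (β : ι) : refl P β * (refl P β * u) = u := by
  rw [← mul_assoc, refl_mul_self, one_mul]

variable [P.IsRootSystem]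

theorem eq_of_act_eq {u v : P.weylGroup} (h : ∀ β, act u β = act v β) : u = v := by
  apply Subtype.ext
  apply RootPairing.Equiv.weightHom_injective P
  apply LinearEquiv.toLinearMap_injective
  refine LinearMap.ext_on_range (v := P.root) RootPairing.IsRootSystem.span_root_eq_top fun i ↦ ?_
  have := congrArg P.root (h i)
  simpa only [root_act_eq] using! this

theorem pairing_act (u : P.weylGroup) (β γ : ι) :
    P.pairing (act u β) (act u γ) = P.pairing β γ := by
  obtain ⟨g, hg⟩ := u
  induction hg using RootPairing.weylGroup.induction generalizing β γ with
  | mem i =>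
    change P.pairing (P.reflectionPerm i β) (P.reflectionPerm i γ) = _
    rw [RootPairing.pairing_reflectionPerm, RootPairing.reflectionPerm_self]
  | one => exact congrArg₂ _ (act_one β) (act_one γ)
  | mul x y hx hy h₁ h₂ =>
    have e : (⟨x * y, mul_mem hx hy⟩ : P.weylGroup) = ⟨x, hx⟩ * ⟨y, hy⟩ := rfl
    rw [e, act_mul, act_mul, h₁, h₂]

theorem root_reflectionPerm' (β γ : ι) :
    P.root (P.reflectionPerm β γ) = P.root γ - P.pairing γ β • P.root β := by
  rw [P.root_reflectionPerm, P.reflection_apply_root]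

theorem act_reflectionPerm (u : P.weylGroup) (β γ : ι) :
    act u (P.reflectionPerm β γ) = P.reflectionPerm (act u β) (act u γ) := by
  apply P.root.injective
  rw [root_reflectionPerm', root_act_eq, root_reflectionPerm', pairing_act, map_sub,
    map_smul, root_act_eq, root_act_eq]

theorem act_act_refl (u : P.weylGroup) (β γ : ι) :
    act u (act (refl P β) γ) = act (refl P (act u β)) (act u γ) :=
  act_reflectionPerm u β γ

theorem refl_act (u : P.weylGroup) (β : ι) : refl P (act u β) * u = u * refl P β := by
  apply eq_of_act_eq
  intro γ
  rw [act_mul, act_mul, act_refl, act_refl, act_reflectionPerm]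

theorem refl_mul_eq (u : P.weylGroup) (α : ι) : refl P α * u = u * refl P (act u⁻¹ α) := by
  rw [← refl_act, act_act_inv]

theorem refl_neg (β : ι) : refl P (neg P β) = refl P β := by
  have := refl_act (refl P β) β
  rw [act_refl_self, refl_mul_self] at this
  rw [eq_inv_of_mul_eq_one_left this, refl_inv]

theorem pairing_refl_left (β γ δ : ι) : P.pairing (act (refl P γ) β) δ =
    P.pairing β δ - P.pairing β γ * P.pairing γ δ := by
  have h : P.root (act (refl P γ) β) = P.root β - P.pairing β γ • P.root γ :=
    root_reflectionPerm' γ β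
  rw [← P.root_coroot_eq_pairing, h]
  simp

end Action

/-! ### Integral pairings. -/

section Pairing

variable [P.IsRootSystem] [CharZero K] [P.IsCrystallographic]

theorem pairingIn_act (u : P.weylGroup) (β γ : ι) :
    P.pairingIn ℤ (act u β) (act u γ) = P.pairingIn ℤ β γ := by
  apply Int.cast_injective (α := K)
  have := pairing_act u β γ
  simpa only [← P.algebraMap_pairingIn ℤ, eq_intCast] using this

theorem pairingIn_act_refl (β γ δ : ι) : P.pairingIn ℤ (act (refl P γ) β) δ =
    P.pairingIn ℤ β δ - P.pairingIn ℤ β γ * P.pairingIn ℤ γ δ := by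
  apply Int.cast_injective (α := K)
  have := pairing_refl_left (P := P) β γ δ
  simp only [← P.algebraMap_pairingIn ℤ, eq_intCast] at this
  push_cast; exact this

theorem pairingIn_act_right (u : P.weylGroup) (β γ : ι) :
    P.pairingIn ℤ β (act u γ) = P.pairingIn ℤ (act u⁻¹ β) γ := by
  rw [← pairingIn_act u⁻¹, act_inv_act]

theorem pairingIn_act_refl_right (β γ δ : ι) : P.pairingIn ℤ β (act (refl P γ) δ) =
    P.pairingIn ℤ β δ - P.pairingIn ℤ γ δ * P.pairingIn ℤ β γ := by
  rw [pairingIn_act_right, refl_inv, pairingIn_act_refl]; ring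

theorem pairingIn_neg_left (β γ : ι) : P.pairingIn ℤ (neg P β) γ = -P.pairingIn ℤ β γ :=
  P.pairingIn_reflectionPerm_self_left ℤ β γ

theorem pairingIn_neg_right (β γ : ι) : P.pairingIn ℤ β (neg P γ) = -P.pairingIn ℤ β γ :=
  P.pairingIn_reflectionPerm_self_right ℤ β γ

theorem pairing_eq_cast (β γ : ι) : P.pairing β γ = (P.pairingIn ℤ β γ : K) := by
  rw [← P.algebraMap_pairingIn ℤ, eq_intCast]

theorem root_act_refl (β γ : ι) : P.root (act (refl P β) γ) =
    P.root γ - (P.pairingIn ℤ γ β : K) • P.root β := by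
  rw [← pairing_eq_cast]; exact root_reflectionPerm' β γ

end Pairing

/-! ### Heights relative to J: detecting Φ^+ and Φ_J. -/

section Height

variable [CharZero K]

/-- The sum of the coefficients of a root at the simple roots outside `J`. -/
def heightOff (b : P.Base) (J : Set ι) (β : ι) : ℤ :=
  ∑ j ∈ b.support with j ∉ J, (b.exists_root_eq_sum_int β).choose j

variable [P.IsRootSystem]

/-- The linear functional which is `0` on the simple roots in `J` and `1` on the others. -/
def offFunctional (b : P.Base) (J : Set ι) : M →ₗ[K] K :=
  b.toWeightBasis.constr K fun j ↦ if (j : ι) ∈ J then (0 : K) else 1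

theorem offFunctional_simple (b : P.Base) (J : Set ι) {j : ι} (hj : j ∈ b.support) :
    offFunctional b J (P.root j) = if j ∈ J then 0 else 1 := by
  have := b.toWeightBasis.constr_basis K (fun j ↦ if (j : ι) ∈ J then (0 : K) else 1) ⟨j, hj⟩
  simpa [offFunctional] using this

theorem offFunctional_sum (b : P.Base) (J : Set ι) (f : ι → ℤ) :
    offFunctional b J (∑ j ∈ b.support, f j • P.root j) =
      ((∑ j ∈ b.support with j ∉ J, f j : ℤ) : K) := by
  rw [map_sum, Int.cast_sum, Finset.sum_filter]
  refine Finset.sum_congr rfl fun j hj ↦ ?_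
  rw [map_zsmul, offFunctional_simple b J hj]
  by_cases h : j ∈ J <;> simp [h]

/-- This frees `heightOff` from the chosen expansion of β and makes it additive. -/
theorem cast_heightOff (b : P.Base) (J : Set ι) (β : ι) :
    (heightOff b J β : K) = offFunctional b J (P.root β) := by
  conv_rhs => rw [(b.exists_root_eq_sum_int β).choose_spec.2.2]
  rw [offFunctional_sum, heightOff]

theorem heightOff_eq_sum (b : P.Base) (J : Set ι) {β : ι} {f : ι → ℤ}
    (h : P.root β = ∑ j ∈ b.support, f j • P.root j) :
    heightOff b J β = ∑ j ∈ b.support with j ∉ J, f j := by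
  apply Int.cast_injective (α := K)
  rw [cast_heightOff, h, offFunctional_sum]

theorem heightOff_empty (b : P.Base) (β : ι) : heightOff b ∅ β = b.height β := by
  obtain ⟨f, -, -, hf⟩ := b.exists_root_eq_sum_int β
  rw [heightOff_eq_sum b ∅ hf, RootPairing.Base.height_eq_sum hf]
  simp

theorem heightOff_empty_ne_zero (b : P.Base) (β : ι) : heightOff b ∅ β ≠ 0 := by
  rw [heightOff_empty]; exact b.height_ne_zero β

theorem mem_posRoots_iff (b : P.Base) (β : ι) : β ∈ posRoots b ↔ 0 < heightOff b ∅ β := by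
  rw [heightOff_empty]; exact b.isPos_iff

theorem heightOff_neg (b : P.Base) (J : Set ι) (β : ι) :
    heightOff b J (neg P β) = -heightOff b J β := by
  apply Int.cast_injective (α := K)
  push_cast
  rw [cast_heightOff, cast_heightOff, root_neg, map_neg]

theorem heightOff_nonneg (b : P.Base) (J : Set ι) {β : ι} (h : 0 < heightOff b ∅ β) :
    0 ≤ heightOff b J β := by
  obtain ⟨f, -, hs | hs, hf⟩ := b.exists_root_eq_sum_int β
  · rw [heightOff_eq_sum b J hf]
    exact Finset.sum_nonneg fun i _ ↦ hs.le i
  · rw [heightOff_eq_sum b ∅ hf] at h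
    exact absurd h (not_lt.2 (Finset.sum_nonpos fun i _ ↦ hs.le i))

theorem heightOff_empty_pos_of_pos (b : P.Base) (J : Set ι) {β : ι} (h : 0 < heightOff b J β) :
    0 < heightOff b ∅ β := by
  by_contra hn
  have h1 : 0 < heightOff b ∅ (neg P β) := by
    have := heightOff_empty_ne_zero b β
    rw [heightOff_neg]; omega
  have := heightOff_nonneg b J h1
  rw [heightOff_neg] at this
  omega

theorem heightOff_simple (b : P.Base) (J : Set ι) {j : ι} (hj : j ∈ b.support) :
    heightOff b J j = if j ∈ J then 0 else 1 := by
  apply Int.cast_injective (α := K)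
  rw [cast_heightOff, offFunctional_simple b J hj]
  split_ifs <;> simp

theorem exists_nonneg_sum (b : P.Base) {β : ι} (h : 0 < heightOff b ∅ β) :
    ∃ f : ι → ℤ, 0 ≤ f ∧ P.root β = ∑ j ∈ b.support, f j • P.root j := by
  obtain ⟨f, -, hs | hs, hf⟩ := b.exists_root_eq_sum_int β
  · exact ⟨f, hs.le, hf⟩
  · rw [heightOff_eq_sum b ∅ hf] at h
    exact absurd h (not_lt.2 (Finset.sum_nonpos fun i _ ↦ hs.le i))

theorem exists_nonneg_sum_of_heightOff_eq_zero (b : P.Base) (J : Set ι) {β : ι}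
    (h : 0 < heightOff b ∅ β) (h0 : heightOff b J β = 0) :
    ∃ f : ι → ℤ, 0 ≤ f ∧ (∀ j ∈ b.support, j ∉ J → f j = 0) ∧
      P.root β = ∑ j ∈ b.support, f j • P.root j := by
  obtain ⟨f, hs, hf⟩ := exists_nonneg_sum b h
  refine ⟨f, hs, ?_, hf⟩
  rw [heightOff_eq_sum b J hf, Finset.sum_eq_zero_iff_of_nonneg fun i _ ↦ hs i] at h0
  exact fun j hj hJ ↦ h0 j (by simp [hj, hJ])

theorem mem_parabolicRoots_iff (b : P.Base) {J : Set ι} (hJ : J ⊆ b.support) (β : ι) :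
    β ∈ parabolicRoots P J ↔ heightOff b J β = 0 := by
  constructor
  · intro h
    have hle : Submodule.span ℤ (P.root '' J) ≤
        (LinearMap.ker (offFunctional b J)).restrictScalars ℤ := by
      rw [Submodule.span_le]
      rintro _ ⟨j, hj, rfl⟩
      simp [offFunctional_simple b J (hJ hj), hj]
    have := hle h
    apply Int.cast_injective (α := K)
    rw [cast_heightOff, Int.cast_zero]
    simpa using this
  · have key : ∀ β, 0 < heightOff b ∅ β → heightOff b J β = 0 → β ∈ parabolicRoots P J := by
      intro β h h0
      obtain ⟨f, -, hz, hf⟩ := exists_nonneg_sum_of_heightOff_eq_zero b J h h0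
      change P.root β ∈ Submodule.span ℤ (P.root '' J)
      rw [hf]
      refine Submodule.sum_mem _ fun j hj ↦ ?_
      by_cases hjJ : j ∈ J
      · exact Submodule.smul_mem _ _ (Submodule.subset_span ⟨j, hjJ, rfl⟩)
      · simp [hz j hj hjJ]
    intro h0
    rcases lt_or_gt_of_ne (heightOff_empty_ne_zero b β) with h | h
    · have := key (neg P β) (by rw [heightOff_neg]; omega) (by rw [heightOff_neg]; omega)
      have h2 : P.root (neg P β) ∈ Submodule.span ℤ (P.root '' J) := this
      rw [root_neg] at h2
      exact (Submodule.neg_mem_iff _).1 h2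
    · exact key β h h0

/-- A root has coefficients of one sign, so a single inequality encodes both positivity and not
lying in Φ_J. -/
theorem mem_label_iff (b : P.Base) {J : Set ι} (hJ : J ⊆ b.support) (β : ι) :
    β ∈ posRoots b \ parabolicRoots P J ↔ 0 < heightOff b J β := by
  rw [Set.mem_sdiff, mem_posRoots_iff, mem_parabolicRoots_iff b hJ]
  constructor
  · rintro ⟨h, h'⟩
    exact lt_of_le_of_ne (heightOff_nonneg b J h) (Ne.symm h')
  · exact fun h ↦ ⟨heightOff_empty_pos_of_pos b J h, h.ne'⟩

variable [P.IsCrystallographic]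

theorem heightOff_act_refl (b : P.Base) (J : Set ι) (β γ : ι) :
    heightOff b J (act (refl P β) γ) =
      heightOff b J γ - P.pairingIn ℤ γ β * heightOff b J β := by
  apply Int.cast_injective (α := K)
  push_cast
  rw [cast_heightOff, cast_heightOff, cast_heightOff, root_act_refl, map_sub, map_smul,
    smul_eq_mul]

theorem heightOff_act_act_refl (b : P.Base) (J : Set ι) (u : P.weylGroup) (β γ : ι) :
    heightOff b J (act u (act (refl P β) γ)) =
      heightOff b J (act u γ) - P.pairingIn ℤ γ β * heightOff b J (act u β) := by
  rw [← pairingIn_act u, ← heightOff_act_refl]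
  rw [act_act_refl]

theorem height_pos_act_simple [Finite ι] [P.IsReduced] (b : P.Base) {α β : ι}
    (hα : α ∈ b.support) (hβ : 0 < heightOff b ∅ β) (hne : β ≠ α) :
    0 < heightOff b ∅ (act (refl P α) β) := by
  rw [heightOff_empty] at *
  exact RootPairing.Base.IsPos.reflectionPerm hβ hα hne

end Height

/-! ### Inversions outside Φ_J and how a right reflection changes their number. -/

section Inversions

variable [Fintype ι] [CharZero K] [P.IsRootSystem]

/-- The indicator of `u(β)` being negative. -/
def invInd (b : P.Base) (u : P.weylGroup) (β : ι) : ℤ :=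
  if heightOff b ∅ (act u β) < 0 then 1 else 0

/-- The number of positive roots outside `Φ_J` which are made negative by `u`. -/
def lenOff (b : P.Base) (J : Set ι) (u : P.weylGroup) : ℤ :=
  ∑ β with 0 < heightOff b J β, invInd b u β

/-- The roots `β ∈ Φ^+ \ Φ_J` with `r_γ(β) ∉ Φ^+ \ Φ_J`. -/
def reflInv (b : P.Base) (J : Set ι) (γ : ι) : Finset ι :=
  {β | 0 < heightOff b J β ∧ heightOff b J (act (refl P γ) β) ≤ 0}

variable [P.IsCrystallographic]

/-- The pairing `⟨γ^∨, 2ρ - 2ρ_J⟩`. -/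
def rhoPairing (b : P.Base) (J : Set ι) (γ : ι) : ℤ :=
  ∑ β with 0 < heightOff b J β, P.pairingIn ℤ β γ

theorem invInd_of_pos (b : P.Base) {u : P.weylGroup} {β : ι}
    (h : 0 < heightOff b ∅ (act u β)) : invInd b u β = 0 :=
  if_neg (by omega)

theorem invInd_of_neg (b : P.Base) {u : P.weylGroup} {β : ι}
    (h : heightOff b ∅ (act u β) < 0) : invInd b u β = 1 :=
  if_pos h

theorem invInd_mul (b : P.Base) (u v : P.weylGroup) (β : ι) :
    invInd b (u * v) β = invInd b u (act v β) := by
  simp only [invInd, act_mul]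

theorem sum_label_eq (b : P.Base) (J : Set ι) (γ : ι) (F : ι → ℤ) :
    ∑ β with 0 < heightOff b J β, F β = ∑ β ∈ reflInv b J γ, F β +
      ∑ β with 0 < heightOff b J β ∧ 0 < heightOff b J (act (refl P γ) β), F β := by
  rw [← Finset.sum_filter_add_sum_filter_not _
    (fun β ↦ heightOff b J (act (refl P γ) β) ≤ 0) F, Finset.filter_filter, Finset.filter_filter]
  simp only [not_le]
  rfl

/-- The involution r_γ preserves this index set, so only `reflInv` can contribute to a change under
r_γ. -/
theorem sum_both_eq (b : P.Base) (J : Set ι) (γ : ι) (F : ι → ℤ) :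
    ∑ β with 0 < heightOff b J β ∧ 0 < heightOff b J (act (refl P γ) β), F (act (refl P γ) β) =
      ∑ β with 0 < heightOff b J β ∧ 0 < heightOff b J (act (refl P γ) β), F β := by
  refine Finset.sum_nbij' (act (refl P γ)) (act (refl P γ)) ?_ ?_ ?_ ?_ ?_ <;>
    simp +contextual [act_refl_refl]

theorem lenOff_refl_sub (b : P.Base) (J : Set ι) (u : P.weylGroup) (γ : ι) :
    lenOff b J (u * refl P γ) - lenOff b J u =
      ∑ β ∈ reflInv b J γ, (invInd b u (act (refl P γ) β) - invInd b u β) := by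
  rw [lenOff, lenOff, sum_label_eq b J γ, sum_label_eq b J γ (invInd b u)]
  simp only [invInd_mul]
  rw [sum_both_eq, Finset.sum_sub_distrib]
  ring

theorem rhoPairing_eq (b : P.Base) (J : Set ι) (γ : ι) :
    rhoPairing b J γ = ∑ β ∈ reflInv b J γ, P.pairingIn ℤ β γ := by
  rw [rhoPairing, sum_label_eq b J γ]
  have h := sum_both_eq b J γ fun β ↦ P.pairingIn ℤ β γ
  -- Since ⟨r_γ β, γ^∨⟩ = -⟨β, γ^∨⟩, invariance of the sum forces it to vanish.
  simp only [pairingIn_act_refl, RootPairing.pairingIn_same, Finset.sum_sub_distrib,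
    ← Finset.sum_mul] at h
  linarith

theorem pairingIn_pos_of_mem_reflInv (b : P.Base) (J : Set ι) {γ β : ι}
    (hγ : 0 < heightOff b J γ) (h : β ∈ reflInv b J γ) : 0 < P.pairingIn ℤ β γ := by
  simp only [reflInv, Finset.mem_filter, Finset.mem_univ, true_and, heightOff_act_refl] at h
  by_contra hn
  nlinarith

theorem self_mem_reflInv (b : P.Base) (J : Set ι) {γ : ι} (hγ : 0 < heightOff b J γ) :
    γ ∈ reflInv b J γ := by
  simp only [reflInv, Finset.mem_filter, Finset.mem_univ, true_and, heightOff_act_refl,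
    RootPairing.pairingIn_same]
  omega

theorem invInd_cases (b : P.Base) (u : P.weylGroup) (β : ι) :
    (0 < heightOff b ∅ (act u β) ∧ invInd b u β = 0) ∨
      (heightOff b ∅ (act u β) < 0 ∧ invInd b u β = 1) := by
  rcases lt_or_gt_of_ne (heightOff_empty_ne_zero b (act u β)) with h | h
  · exact .inr ⟨h, invInd_of_neg b h⟩
  · exact .inl ⟨h, invInd_of_pos b h⟩

/-- Here u r_γ β is uβ minus a positive multiple of the positive root uγ, so it cannot be positive
when uβ is negative. -/
theorem invInd_diff_of_pos (b : P.Base) (J : Set ι) {u : P.weylGroup} {γ β : ι}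
    (hγ : 0 < heightOff b J γ) (hu : 0 < heightOff b ∅ (act u γ)) (h : β ∈ reflInv b J γ) :
    0 ≤ invInd b u (act (refl P γ) β) - invInd b u β ∧
      invInd b u (act (refl P γ) β) - invInd b u β ≤ 1 := by
  have hp := pairingIn_pos_of_mem_reflInv b J hγ h
  have e := heightOff_act_act_refl b ∅ u γ β
  have hm := mul_pos hp hu
  rcases invInd_cases b u β with ⟨h1, h2⟩ | ⟨h1, h2⟩ <;>
  rcases invInd_cases b u (act (refl P γ) β) with ⟨h3, h4⟩ | ⟨h3, h4⟩ <;> omega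

theorem invInd_refl_self (b : P.Base) (u : P.weylGroup) (γ : ι) :
    invInd b u (act (refl P γ) γ) = 1 - invInd b u γ := by
  have e : heightOff b ∅ (act u (act (refl P γ) γ)) = -heightOff b ∅ (act u γ) := by
    rw [act_refl_self, act_neg, heightOff_neg]
  rcases invInd_cases b u γ with ⟨h1, h2⟩ | ⟨h1, h2⟩ <;>
  rcases invInd_cases b u (act (refl P γ) γ) with ⟨h3, h4⟩ | ⟨h3, h4⟩ <;> omega

/-- Each β in `reflInv` contributes between 0 and min(1, ⟨β, γ^∨⟩). The term β = γ contributes 1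
while its pairing is 2, which gives the 1 in both bounds. -/
theorem lenOff_refl_of_pos (b : P.Base) (J : Set ι) {u : P.weylGroup} {γ : ι}
    (hγ : 0 < heightOff b J γ) (hu : 0 < heightOff b ∅ (act u γ)) :
    1 ≤ lenOff b J (u * refl P γ) - lenOff b J u ∧
      lenOff b J (u * refl P γ) - lenOff b J u ≤ rhoPairing b J γ - 1 := by
  have hs := self_mem_reflInv b J hγ
  have e1 := invInd_refl_self b u γ
  have e2 := invInd_of_pos b hu
  rw [lenOff_refl_sub, rhoPairing_eq]
  constructor
  · refine le_trans ?_ (Finset.single_le_sum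
      (fun β hβ ↦ (invInd_diff_of_pos b J hγ hu hβ).1) hs)
    omega
  · have := Finset.single_le_sum (f := fun β ↦ P.pairingIn ℤ β γ -
      (invInd b u (act (refl P γ) β) - invInd b u β)) (fun β hβ ↦ by
        have h1 := (invInd_diff_of_pos b J hγ hu hβ).2
        have h2 := pairingIn_pos_of_mem_reflInv b J hγ hβ
        omega) hs
    rw [Finset.sum_sub_distrib] at this
    simp only [RootPairing.pairingIn_same] at this
    omega

theorem lenOff_refl_of_neg (b : P.Base) (J : Set ι) {u : P.weylGroup} {γ : ι}
    (hγ : 0 < heightOff b J γ) (hu : heightOff b ∅ (act u γ) < 0) :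
    1 - rhoPairing b J γ ≤ lenOff b J (u * refl P γ) - lenOff b J u ∧
      lenOff b J (u * refl P γ) - lenOff b J u ≤ -1 := by
  have hu' : 0 < heightOff b ∅ (act (u * refl P γ) γ) := by
    rw [act_mul, act_refl_self, act_neg, heightOff_neg]; omega
  have := lenOff_refl_of_pos b J hγ hu'
  rw [mul_refl_refl] at this
  omega

theorem two_le_rhoPairing (b : P.Base) (J : Set ι) {γ : ι} (hγ : 0 < heightOff b J γ) :
    2 ≤ rhoPairing b J γ := by
  have := lenOff_refl_of_pos b J hγ (u := 1)
    (by rw [act_one]; exact heightOff_empty_pos_of_pos b J hγ)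
  omega

/-- A simple reflection preserves positivity of every positive root but its own, so only β = γ
contributes. -/
theorem lenOff_refl_of_simple [P.IsReduced] (b : P.Base) (J : Set ι) {u : P.weylGroup} {γ : ι}
    (hγ : 0 < heightOff b J γ) (hu : act u γ ∈ b.support) :
    lenOff b J (u * refl P γ) - lenOff b J u = 1 := by
  have hpos : 0 < heightOff b ∅ (act u γ) := by rw [heightOff_simple b ∅ hu]; simp
  rw [lenOff_refl_sub, Finset.sum_eq_single_of_mem γ (self_mem_reflInv b J hγ)]
  · rw [invInd_refl_self, invInd_of_pos b hpos]; norm_num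
  · intro β hβ hne
    have h1 := invInd_diff_of_pos b J hγ hpos hβ
    rcases invInd_cases b u β with ⟨h2, h3⟩ | ⟨h2, h3⟩
    · have h4 := height_pos_act_simple b hu h2 ((act_injective u).ne hne)
      rw [← act_act_refl] at h4
      rw [h3, invInd_of_pos b h4, sub_zero]
    · have : invInd b u (act (refl P γ) β) ≤ 1 := by unfold invInd; split_ifs <;> norm_num
      omega

end Inversions

/-! ### The highest root: dominance and pairings at most one. -/

section HighestRoot

variable [CharZero K] [P.IsRootSystem]

theorem heightOff_le_of_sub_mem (b : P.Base) {β γ : ι}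
    (h : P.root β - P.root γ ∈ AddSubmonoid.closure (P.root '' b.support)) :
    heightOff b ∅ γ ≤ heightOff b ∅ β := by
  have key : ∀ x ∈ AddSubmonoid.closure (P.root '' b.support),
      ∃ n : ℕ, offFunctional b ∅ x = n := by
    intro x hx
    induction hx using AddSubmonoid.closure_induction with
    | mem x hx =>
      obtain ⟨j, hj, rfl⟩ := hx
      exact ⟨1, by simp [offFunctional_simple b ∅ hj]⟩
    | zero => exact ⟨0, by simp⟩
    | add x y _ _ h₁ h₂ =>
      obtain ⟨n, hn⟩ := h₁
      obtain ⟨m, hm⟩ := h₂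
      exact ⟨n + m, by rw [map_add, hn, hm, Nat.cast_add]⟩
  obtain ⟨n, hn⟩ := key _ h
  rw [map_sub, ← cast_heightOff, ← cast_heightOff] at hn
  have : heightOff b ∅ β - heightOff b ∅ γ = n := by
    apply Int.cast_injective (α := K); push_cast; exact hn
  omega

theorem IsHighestRoot.height_le {b : P.Base} {θ : ι} (hθ : IsHighestRoot b θ) (β : ι) :
    heightOff b ∅ β ≤ heightOff b ∅ θ :=
  heightOff_le_of_sub_mem b (hθ β)

theorem IsHighestRoot.eq_of_height_eq {b : P.Base} {θ β : ι} (hθ : IsHighestRoot b θ)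
    (h : heightOff b ∅ β = heightOff b ∅ θ) : β = θ := by
  have key : ∀ x ∈ AddSubmonoid.closure (P.root '' b.support),
      x = 0 ∨ ∃ n : ℕ, 0 < n ∧ offFunctional b ∅ x = n := by
    intro x hx
    induction hx using AddSubmonoid.closure_induction with
    | mem x hx =>
      obtain ⟨j, hj, rfl⟩ := hx
      exact .inr ⟨1, one_pos, by simp [offFunctional_simple b ∅ hj]⟩
    | zero => exact .inl rfl
    | add x y _ _ h₁ h₂ =>
      rcases h₁ with rfl | ⟨n, hn0, hn⟩
      · simpa using h₂
      · rcases h₂ with rfl | ⟨m, hm0, hm⟩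
        · simpa using Or.inr ⟨n, hn0, hn⟩
        · exact .inr ⟨n + m, by omega, by rw [map_add, hn, hm, Nat.cast_add]⟩
  rcases key _ (hθ β) with h0 | ⟨n, hn0, hn⟩
  · exact (P.root.injective (sub_eq_zero.1 h0)).symm
  · rw [map_sub, ← cast_heightOff, ← cast_heightOff, h, sub_self] at hn
    exact absurd (Nat.cast_eq_zero.1 hn.symm) hn0.ne'

theorem IsHighestRoot.pos {b : P.Base} {θ : ι} (hθ : IsHighestRoot b θ) :
    0 < heightOff b ∅ θ := by
  have h1 := hθ.height_le (neg P θ)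
  have h2 := heightOff_empty_ne_zero b θ
  rw [heightOff_neg] at h1
  omega

variable [Fintype ι] [P.IsCrystallographic]

theorem pairingIn_eq_sum (b : P.Base) {β : ι} {f : ι → ℤ}
    (h : P.root β = ∑ j ∈ b.support, f j • P.root j) (γ : ι) :
    P.pairingIn ℤ β γ = ∑ j ∈ b.support, f j * P.pairingIn ℤ j γ := by
  apply Int.cast_injective (α := K)
  push_cast
  simp only [← pairing_eq_cast, ← P.root_coroot_eq_pairing, h, map_sum, map_zsmul,
    LinearMap.sum_apply, LinearMap.smul_apply, zsmul_eq_mul]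

theorem IsHighestRoot.pairingIn_nonneg {b : P.Base} {θ β : ι} (hθ : IsHighestRoot b θ)
    (hβ : 0 < heightOff b ∅ β) : 0 ≤ P.pairingIn ℤ β θ := by
  obtain ⟨f, hf0, hf⟩ := exists_nonneg_sum b hβ
  rw [pairingIn_eq_sum b hf]
  refine Finset.sum_nonneg fun j hj ↦ mul_nonneg (hf0 j) ?_
  by_contra hn
  have h1 : P.pairingIn ℤ θ j < 0 := by
    have h2 := P.pairingIn_lt_zero_iff ℤ (i := j) (j := θ)
    exact h2.1 (not_le.1 hn)
  -- If θ paired negatively with the simple coroot of j, then r_j θ would be higher than θ.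
  have h3 := hθ.height_le (act (refl P j) θ)
  rw [heightOff_act_refl, heightOff_simple b ∅ hj] at h3
  simp at h3
  omega

theorem IsHighestRoot.pairingIn_le_one {b : P.Base} {θ β : ι} (hθ : IsHighestRoot b θ)
    (hne : β ≠ θ) : P.pairingIn ℤ β θ ≤ 1 := by
  by_contra hn
  -- With k = ⟨β, θ^∨⟩ ≥ 2, the root -r_θ β = kθ - β has height at most that of θ, so β has at least
  -- the height of θ.
  have h1 := hθ.height_le (neg P (act (refl P θ) β))
  rw [heightOff_neg, heightOff_act_refl] at h1
  have h2 := hθ.height_le β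
  have h3 := hθ.pos
  have h4 : 2 * heightOff b ∅ θ ≤ P.pairingIn ℤ β θ * heightOff b ∅ θ :=
    mul_le_mul_of_nonneg_right (by omega) h3.le
  exact hne (hθ.eq_of_height_eq (by omega))

theorem IsHighestRoot.height_pos {b : P.Base} {θ β : ι} (hθ : IsHighestRoot b θ)
    (h : 0 < P.pairingIn ℤ β θ) : 0 < heightOff b ∅ β := by
  by_contra hn
  have h1 : 0 < heightOff b ∅ (neg P β) := by
    have := heightOff_empty_ne_zero b β
    rw [heightOff_neg]; omega
  have := hθ.pairingIn_nonneg h1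
  rw [pairingIn_neg_left] at this
  omega

/-- Every β ≠ γ in `reflInv` has ⟨β, γ^∨⟩ = 1 and passes from negative to positive, so its sign
change cancels its pairing. The term β = γ gives -1 + 2 = 1. -/
theorem lenOff_refl_of_highestRoot (b : P.Base) (J : Set ι) {θ : ι}
    (hθ : IsHighestRoot b θ) {u : P.weylGroup} {γ : ι}
    (hγ : 0 < heightOff b J γ) (hu : act u γ = neg P θ) :
    lenOff b J (u * refl P γ) - lenOff b J u = 1 - rhoPairing b J γ := by
  have hneg : heightOff b ∅ (act u γ) < 0 := by
    rw [hu, heightOff_neg]; have := hθ.pos; omega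
  have hs := self_mem_reflInv b J hγ
  have key : ∑ β ∈ reflInv b J γ, (invInd b u (act (refl P γ) β) - invInd b u β +
      P.pairingIn ℤ β γ) = 1 := by
    rw [Finset.sum_eq_single_of_mem γ hs]
    · rw [invInd_refl_self, invInd_of_neg b hneg, RootPairing.pairingIn_same]; norm_num
    · intro β hβ hne
      have h0 := pairingIn_pos_of_mem_reflInv b J hγ hβ
      have e : P.pairingIn ℤ β γ = P.pairingIn ℤ (neg P (act u β)) θ := by
        rw [← pairingIn_act u, hu, pairingIn_neg_right, pairingIn_neg_left]
      have h1 : P.pairingIn ℤ β γ ≤ 1 := by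
        rw [e]
        refine hθ.pairingIn_le_one fun h ↦ hne ?_
        apply act_injective u
        rw [hu, ← h, neg_neg]
      have h2 : 0 < heightOff b ∅ (neg P (act u β)) := hθ.height_pos (by omega)
      have h3 : 0 < heightOff b ∅ (act u (act (refl P γ) β)) := by
        apply hθ.height_pos
        rw [act_act_refl, hu, refl_neg, pairingIn_act_refl, RootPairing.pairingIn_same]
        rw [pairingIn_neg_left] at e
        omega
      rw [heightOff_neg] at h2
      rw [invInd_of_pos b h3, invInd_of_neg b (by omega)]
      omega
  rw [Finset.sum_add_distrib] at key
  rw [lenOff_refl_sub, rhoPairing_eq]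
  omega

end HighestRoot

/-! ### Left multiplication by a simple reflection or by r_θ. -/

section VerticalEdges

variable [Fintype ι] [CharZero K] [P.IsRootSystem] [P.IsCrystallographic]

/-- The length of `⌊r_α u⌋` differs from that of `⌊u⌋` as for an edge of the type given by
`χ = 0` (Bruhat) or `χ = 1` (quantum), whenever the label `u⁻¹(α)` is in `Φ^+ \ Φ_J`. -/
def IsAffineSimple (b : P.Base) (J : Set ι) (α : ι) (χ : ℤ) : Prop :=
  ∀ (u : P.weylGroup) (γ : ι), 0 < heightOff b J γ → act u γ = α →
    lenOff b J (u * refl P γ) - lenOff b J u = 1 - χ * rhoPairing b J γ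

theorem isAffineSimple_simple [P.IsReduced] (b : P.Base) (J : Set ι) {α : ι}
    (hα : α ∈ b.support) : IsAffineSimple b J α 0 := by
  rintro u γ hγ rfl
  rw [lenOff_refl_of_simple b J hγ hα]; ring

theorem isAffineSimple_neg_highestRoot (b : P.Base) (J : Set ι) {θ : ι}
    (hθ : IsHighestRoot b θ) : IsAffineSimple b J (neg P θ) 1 := by
  intro u γ hγ hu
  rw [lenOff_refl_of_highestRoot b J hθ hγ hu, one_mul]

theorem rhoPairing_neg (b : P.Base) (J : Set ι) (γ : ι) :
    rhoPairing b J (neg P γ) = -rhoPairing b J γ := by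
  simp only [rhoPairing, pairingIn_neg_right, Finset.sum_neg_distrib]

theorem rhoPairing_act_refl (b : P.Base) (J : Set ι) (γ δ : ι) :
    rhoPairing b J (act (refl P γ) δ) =
      rhoPairing b J δ - P.pairingIn ℤ γ δ * rhoPairing b J γ := by
  simp only [rhoPairing, pairingIn_act_refl_right, Finset.sum_sub_distrib, Finset.mul_sum]

theorem reflInv_eq_empty (b : P.Base) (J : Set ι) {γ : ι} (h : heightOff b J γ = 0) :
    reflInv b J γ = ∅ := by
  simp only [reflInv, heightOff_act_refl, h, mul_zero, sub_zero]
  ext β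
  simp

theorem rhoPairing_eq_zero (b : P.Base) (J : Set ι) {γ : ι} (h : heightOff b J γ = 0) :
    rhoPairing b J γ = 0 := by
  rw [rhoPairing_eq, reflInv_eq_empty b J h, Finset.sum_empty]

/-- If u⁻¹α is in Φ_J, nothing changes. If its negative is in Φ^+ \ Φ_J, the defining property is
read backwards, starting from r_α u. -/
theorem IsAffineSimple.lenOff_refl_mul {b : P.Base} {J : Set ι} {α : ι} {χ : ℤ}
    (hα : IsAffineSimple b J α χ) (u : P.weylGroup) :
    lenOff b J (refl P α * u) - lenOff b J u =
      (heightOff b J (act u⁻¹ α)).sign - χ * rhoPairing b J (act u⁻¹ α) := by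
  rw [refl_mul_eq]
  rcases lt_trichotomy (heightOff b J (act u⁻¹ α)) 0 with h | h | h
  · have h1 := hα (u * refl P (act u⁻¹ α)) (neg P (act u⁻¹ α)) (by rw [heightOff_neg]; omega)
      (by rw [act_mul, ← act_refl_self, act_refl_refl, act_act_inv])
    rw [refl_neg, mul_refl_refl, rhoPairing_neg] at h1
    rw [Int.sign_eq_neg_one_of_neg h]
    linarith
  · rw [lenOff_refl_sub, rhoPairing_eq_zero b J h, reflInv_eq_empty b J h, h]
    simp
  · rw [hα u _ h (act_act_inv u α), Int.sign_eq_one_of_pos h]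

theorem lenOff_simple_mul [P.IsReduced] (b : P.Base) {α : ι} (hα : α ∈ b.support)
    (u : P.weylGroup) :
    lenOff b ∅ (refl P α * u) - lenOff b ∅ u = (heightOff b ∅ (act u⁻¹ α)).sign := by
  rw [(isAffineSimple_simple b ∅ hα).lenOff_refl_mul]; ring

theorem lenOff_one (b : P.Base) (J : Set ι) : lenOff b J (1 : P.weylGroup) = 0 :=
  Finset.sum_eq_zero fun β hβ ↦ invInd_of_pos b (by
    rw [act_one]; exact heightOff_empty_pos_of_pos b J (Finset.mem_filter.1 hβ).2)

end VerticalEdges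

/-! ### Words in simple reflections; length equals the number of inversions. -/

section Words

variable [Finite ι] [CharZero K] [P.IsRootSystem] [P.IsCrystallographic] [P.IsReduced]

/-- `l` is an expression of `w` as a product of simple reflections. -/
def IsWord (b : P.Base) (w : P.weylGroup) (l : List ι) : Prop :=
  (∀ i ∈ l, i ∈ b.support) ∧ (l.map (refl P)).prod = w

theorem IsWord.cons {b : P.Base} {w : P.weylGroup} {l : List ι} (h : IsWord b w l) {i : ι}
    (hi : i ∈ b.support) : IsWord b (refl P i * w) (i :: l) :=
  ⟨by simpa using ⟨hi, h.1⟩, by simp [h.2]⟩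

theorem IsWord.append {b : P.Base} {u v : P.weylGroup} {l l' : List ι} (h : IsWord b u l)
    (h' : IsWord b v l') : IsWord b (u * v) (l ++ l') :=
  ⟨fun i hi ↦ (List.mem_append.1 hi).elim (h.1 i) (h'.1 i), by simp [h.2, h'.2]⟩

theorem exists_isWord_refl (b : P.Base) (β : ι) : ∃ l, IsWord b (refl P β) l := by
  refine RootPairing.Base.induction_reflect (b := b) β
    (p := fun β ↦ ∃ l, IsWord b (refl P β) l) ?_ ?_ ?_
  · rintro i ⟨l, hl⟩
    exact ⟨l, by rw [← refl_neg] at hl; exact hl⟩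
  · exact fun i hi ↦ ⟨[i], by simpa using hi, by simp⟩
  · rintro i j ⟨l, hl⟩ hj
    refine ⟨j :: (l ++ [j]), ?_⟩
    have h1 : IsWord b (refl P j) [j] := ⟨by simpa using hj, by simp⟩
    have h2 := (hl.append h1).cons hj
    rwa [← mul_assoc, ← refl_act (refl P j) i, mul_refl_refl] at h2

theorem exists_isWord (b : P.Base) (w : P.weylGroup) : ∃ l, IsWord b w l := by
  obtain ⟨g, hg⟩ := w
  induction hg using RootPairing.weylGroup.induction with
  | mem i => exact exists_isWord_refl b i
  | one => exact ⟨[], by simp, rfl⟩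
  | mul x y hx hy h₁ h₂ =>
    obtain ⟨l, hl⟩ := h₁
    obtain ⟨l', hl'⟩ := h₂
    exact ⟨l ++ l', hl.append hl'⟩

theorem IsWord.length_le {b : P.Base} {w : P.weylGroup} {l : List ι} (h : IsWord b w l) :
    length b w ≤ l.length :=
  Nat.sInf_le ⟨l, h.1, h.2, rfl⟩

theorem exists_isWord_length_eq (b : P.Base) (w : P.weylGroup) :
    ∃ l, IsWord b w l ∧ l.length = length b w := by
  obtain ⟨l, hl⟩ := exists_isWord b w
  obtain ⟨l', h1, h2, h3⟩ := Nat.sInf_mem (s := {n | ∃ l : List ι, (∀ i ∈ l, i ∈ b.support) ∧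
    (l.map (refl P)).prod = w ∧ l.length = n}) ⟨_, l, hl.1, hl.2, rfl⟩
  exact ⟨l', ⟨h1, h2⟩, h3⟩

/-- The strong exchange property. -/
theorem IsWord.exchange {b : P.Base} {w : P.weylGroup} {l : List ι} (h : IsWord b w l) {β : ι}
    (hβ : 0 < heightOff b ∅ β) (hw : heightOff b ∅ (act w⁻¹ β) < 0) :
    ∃ l', IsWord b (refl P β * w) l' ∧ l'.length + 1 = l.length := by
  induction l generalizing w β with
  | nil =>
    obtain rfl : w = 1 := by simpa using h.2.symm
    rw [inv_one, act_one] at hw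
    omega
  | cons j l ih =>
    have hj : j ∈ b.support := h.1 j (by simp)
    have hp : IsWord b (refl P j * w) l :=
      ⟨fun i hi ↦ h.1 i (by simp [hi]), by rw [← h.2]; simp [refl_mul_refl_mul]⟩
    by_cases hjb : β = j
    · subst hjb
      exact ⟨l, hp, by simp⟩
    · have h1 := height_pos_act_simple b hj hβ hjb
      obtain ⟨l', h2, h3⟩ := ih hp h1
        (by rwa [mul_inv_rev, refl_inv, act_mul, act_refl_refl])
      refine ⟨j :: l', ?_, by simp [h3]⟩
      have h4 := h2.cons hj
      -- Conjugating the shorter word for r_{r_j β} r_j w by r_j turns it into one for r_β w.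
      rwa [← mul_assoc (refl P _), ← refl_act, act_refl_refl, mul_assoc, refl_mul_refl_mul] at h4

theorem length_eq_lenOff [Fintype ι] (b : P.Base) (w : P.weylGroup) :
    (length b w : ℤ) = lenOff b ∅ w := by
  obtain ⟨l, hl, hn⟩ := exists_isWord_length_eq b w
  induction l generalizing w with
  | nil =>
    obtain rfl : w = 1 := by simpa using hl.2.symm
    rw [lenOff_one, ← hn]; rfl
  | cons j l ih =>
    have hj : j ∈ b.support := hl.1 j (by simp)
    have hp : IsWord b (refl P j * w) l :=
      ⟨fun i hi ↦ hl.1 i (by simp [hi]), by rw [← hl.2]; simp [refl_mul_refl_mul]⟩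
    obtain ⟨m, hm, hm'⟩ := exists_isWord_length_eq b (refl P j * w)
    have h1 := hp.length_le
    have h2 := (hm.cons hj).length_le
    rw [refl_mul_refl_mul] at h2
    simp only [List.length_cons] at hn h2
    have h3 := ih _ hp (by omega)
    have h4 := lenOff_simple_mul b hj (refl P j * w)
    rw [refl_mul_refl_mul] at h4
    rcases lt_or_gt_of_ne (heightOff_empty_ne_zero b (act (refl P j * w)⁻¹ j)) with h | h
    -- A descent here would give, by exchange, a word for w shorter than the minimal one.
    · obtain ⟨l', h5, h6⟩ := hp.exchange (by rw [heightOff_simple b ∅ hj]; simp) h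
      rw [refl_mul_refl_mul] at h5
      have := h5.length_le
      omega
    · rw [Int.sign_eq_one_of_pos h] at h4
      omega

end Words

/-! ### Bruhat order: covers are the reflections raising length by one. -/

section Bruhat

variable [Fintype ι] [CharZero K] [P.IsRootSystem] [P.IsCrystallographic] [P.IsReduced]

/-- `y = x r_β` for a root `β`, and `ℓ(x) < ℓ(y)`. -/
def BruhatStep (b : P.Base) (x y : P.weylGroup) : Prop :=
  ∃ β : ι, y = x * refl P β ∧ length b x < length b y

theorem bruhatStep_iff (b : P.Base) (x y : P.weylGroup) : BruhatStep b x y ↔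
    ∃ β, y = x * refl P β ∧ 0 < heightOff b ∅ β ∧ 0 < heightOff b ∅ (act x β) := by
  have key : ∀ β, 0 < heightOff b ∅ β →
      (length b x < length b (x * refl P β) ↔ 0 < heightOff b ∅ (act x β)) := by
    intro β hβ
    have h1 := length_eq_lenOff b x
    have h2 := length_eq_lenOff b (x * refl P β)
    rcases lt_or_gt_of_ne (heightOff_empty_ne_zero b (act x β)) with h | h
    · have := lenOff_refl_of_neg b ∅ hβ h
      constructor <;> intro <;> omega
    · have := lenOff_refl_of_pos b ∅ hβ h
      constructor <;> intro <;> omega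
  constructor
  · rintro ⟨β, rfl, h⟩
    rcases lt_or_gt_of_ne (heightOff_empty_ne_zero b β) with h1 | h1
    · have h2 : 0 < heightOff b ∅ (neg P β) := by rw [heightOff_neg]; omega
      rw [← refl_neg] at h ⊢
      exact ⟨_, rfl, h2, (key _ h2).1 h⟩
    · exact ⟨_, rfl, h1, (key _ h1).1 h⟩
  · rintro ⟨β, rfl, h1, h2⟩
    exact ⟨β, rfl, (key _ h1).2 h2⟩

theorem BruhatStep.simple_mul {b : P.Base} {x y : P.weylGroup} (h : BruhatStep b x y) {α : ι}
    (hα : α ∈ b.support) (hne : y ≠ refl P α * x) :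
    BruhatStep b (refl P α * x) (refl P α * y) := by
  rw [bruhatStep_iff] at h ⊢
  obtain ⟨β, rfl, h1, h2⟩ := h
  refine ⟨β, by rw [mul_assoc], h1, ?_⟩
  rw [act_mul]
  refine height_pos_act_simple b hα h2 fun h3 ↦ hne ?_
  rw [← h3, refl_act]

theorem length_simple_mul_ne (b : P.Base) {α : ι} (hα : α ∈ b.support) (x : P.weylGroup) :
    length b (refl P α * x) ≠ length b x := by
  have h1 := length_eq_lenOff b x
  have h2 := length_eq_lenOff b (refl P α * x)
  have h3 := lenOff_simple_mul b hα x
  have h4 := mt Int.sign_eq_zero_iff_zero.1 (heightOff_empty_ne_zero b (act x⁻¹ α))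
  omega

theorem length_simple_mul_le (b : P.Base) {α : ι} (hα : α ∈ b.support) (x : P.weylGroup) :
    length b (refl P α * x) ≤ length b x + 1 := by
  obtain ⟨l, hl, hn⟩ := exists_isWord_length_eq b x
  have := (hl.cons hα).length_le
  simp only [List.length_cons] at this
  omega

theorem bruhatStep_simple_mul (b : P.Base) (α : ι) {x : P.weylGroup}
    (h : length b x < length b (refl P α * x)) : BruhatStep b x (refl P α * x) :=
  ⟨_, refl_mul_eq x α, h⟩

theorem bruhatStep_simple_mul' (b : P.Base) (α : ι) {x : P.weylGroup}
    (h : length b (refl P α * x) < length b x) : BruhatStep b (refl P α * x) x := by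
  have := bruhatStep_simple_mul b α (x := refl P α * x) (by rwa [refl_mul_refl_mul])
  rwa [refl_mul_refl_mul] at this

/-- The longer one of `x` and `r_α x`. -/
def upper (b : P.Base) (α : ι) (x : P.weylGroup) : P.weylGroup :=
  if length b x < length b (refl P α * x) then refl P α * x else x

/-- A form of the lifting property: passing to the longer element of {x, r_α x} is monotone. -/
theorem BruhatStep.upper_le {b : P.Base} {x y : P.weylGroup} (h : BruhatStep b x y) {α : ι}
    (hα : α ∈ b.support) :
    Relation.ReflTransGen (BruhatStep b) (upper b α x) (upper b α y) := by
  by_cases hy : y = refl P α * x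
  · subst hy
    have h1 : length b x < length b (refl P α * x) := h.choose_spec.2
    unfold upper
    rw [if_pos h1, refl_mul_refl_mul, if_neg (by omega)]
  · have h1 := h.simple_mul hα hy
    have h2 := length_simple_mul_ne b hα y
    unfold upper
    split_ifs with h3 h4 h4
    · exact .single h1
    · exact .head h1 (.single (bruhatStep_simple_mul' b α (by omega)))
    · exact .head h (.single (bruhatStep_simple_mul b α h4))
    · exact .single h

theorem upper_le_of_bruhatLT {b : P.Base} {x y : P.weylGroup} (h : BruhatLT b x y) {α : ι}
    (hα : α ∈ b.support) :
    Relation.ReflTransGen (BruhatStep b) (upper b α x) (upper b α y) := by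
  induction h with
  | single h => exact BruhatStep.upper_le h hα
  | tail _ h ih => exact ih.trans (BruhatStep.upper_le h hα)

theorem BruhatLT.length_lt {b : P.Base} {x y : P.weylGroup} (h : BruhatLT b x y) :
    length b x < length b y := by
  induction h with
  | single h => exact h.choose_spec.2
  | tail _ h ih => exact ih.trans h.choose_spec.2

theorem exists_simple_mul_length_lt (b : P.Base) {y : P.weylGroup} (h : 0 < length b y) :
    ∃ α ∈ b.support, length b (refl P α * y) < length b y := by
  obtain ⟨l, hl, hn⟩ := exists_isWord_length_eq b y
  cases l with
  | nil => simp at hn; omega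
  | cons j l =>
    have hp : IsWord b (refl P j * y) l :=
      ⟨fun i hi ↦ hl.1 i (by simp [hi]), by rw [← hl.2]; simp [refl_mul_refl_mul]⟩
    have := hp.length_le
    simp only [List.length_cons] at hn
    exact ⟨j, hl.1 j (by simp), by omega⟩

/-- Induction on ℓ(y), through a left descent α of y. If α is an ascent of x, then r_α x lies
between. Otherwise an element between r_α x and r_α y is lifted. -/
theorem exists_between (b : P.Base) {x y : P.weylGroup} (h : BruhatStep b x y)
    (hlt : length b x + 1 < length b y) : ∃ u, BruhatLT b x u ∧ BruhatLT b u y := by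
  obtain ⟨n, hn⟩ : ∃ n, length b y = n := ⟨_, rfl⟩
  induction n using Nat.strong_induction_on generalizing x y with
  | _ n ih =>
    subst hn
    obtain ⟨α, hα, hy⟩ := exists_simple_mul_length_lt b (y := y) (by omega)
    have hya := bruhatStep_simple_mul' b α hy
    have hy1 := length_simple_mul_le b hα (refl P α * y)
    rw [refl_mul_refl_mul] at hy1
    have hx1 := length_simple_mul_le b hα x
    have hne : y ≠ refl P α * x := by rintro rfl; omega
    have hs := h.simple_mul hα hne
    by_cases hx : length b x < length b (refl P α * x)
    · exact ⟨_, .single (bruhatStep_simple_mul b α hx), .head hs (.single hya)⟩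
    · have hx2 := length_simple_mul_ne b hα x
      have hxs := bruhatStep_simple_mul' b α (x := x) (by omega)
      obtain ⟨u, hu1, hu2⟩ := ih _ hy hs (by omega) rfl
      have h1 := upper_le_of_bruhatLT hu1 hα
      have h2 := upper_le_of_bruhatLT hu2 hα
      have e1 : upper b α (refl P α * x) = x := by
        unfold upper; rw [refl_mul_refl_mul, if_pos (by omega)]
      have e2 : upper b α (refl P α * y) = y := by
        unfold upper; rw [refl_mul_refl_mul, if_pos hy]
      rw [e1] at h1
      rw [e2] at h2
      have l1 := hu1.length_lt
      have l2 := hu2.length_lt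
      -- If the lift of u collapses onto x, then u = x and r_α y lies between. It cannot collapse
      -- onto y for reasons of length.
      rcases Relation.reflTransGen_iff_eq_or_transGen.1 h1 with h3 | h3
      · have hux : u = x := by
          unfold upper at h3
          split_ifs at h3 with h4
          · rw [← h3, refl_mul_refl_mul] at l1; omega
          · exact h3
        subst hux
        exact ⟨_, hu2, .single hya⟩
      rcases Relation.reflTransGen_iff_eq_or_transGen.1 h2 with h5 | h5
      · exfalso
        unfold upper at h5
        split_ifs at h5 with h4
        · rw [h5, refl_mul_refl_mul] at l2; omega
        · subst h5; omega
      · exact ⟨_, h3, h5⟩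

theorem bruhatCovBy_iff (b : P.Base) (x : P.weylGroup) (β : ι) :
    BruhatCovBy b x (x * refl P β) ↔ length b (x * refl P β) = length b x + 1 := by
  constructor
  · rintro ⟨h, h'⟩
    have h1 := h.length_lt
    by_contra hne
    obtain ⟨u, hu, hu'⟩ := exists_between b (x := x) (y := x * refl P β) ⟨β, rfl, h1⟩ (by omega)
    exact h' u hu hu'
  · intro h
    refine ⟨.single ⟨β, rfl, by omega⟩, fun u hu hu' ↦ ?_⟩
    have h1 := hu.length_lt
    have h2 := hu'.length_lt
    omega

end Bruhat

/-! ### Cosets of W_J and their minimal representatives. -/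

section Parabolic

variable [Fintype ι] [CharZero K] [P.IsRootSystem] [P.IsCrystallographic]

theorem heightOff_act_of_mem_parabolic (b : P.Base) {J : Set ι} (hJ : J ⊆ b.support)
    {z : P.weylGroup} (hz : z ∈ parabolic P J) (β : ι) :
    heightOff b J (act z β) = heightOff b J β := by
  induction hz using Subgroup.closure_induction generalizing β with
  | mem x hx =>
    obtain ⟨j, hj, rfl⟩ := hx
    rw [heightOff_act_refl, heightOff_simple b J (hJ hj), if_pos hj]; ring
  | one => rw [act_one]
  | mul x y _ _ hx hy => rw [act_mul, hx, hy]
  | inv x _ hx => rw [← hx, act_act_inv]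

/-- W_J permutes Φ^+ \ Φ_J, because it preserves the height off J. -/
theorem lenOff_mul_of_mem_parabolic (b : P.Base) {J : Set ι} (hJ : J ⊆ b.support)
    (u : P.weylGroup) {z : P.weylGroup} (hz : z ∈ parabolic P J) :
    lenOff b J (u * z) = lenOff b J u := by
  refine Finset.sum_nbij' (act z) (act z⁻¹) ?_ ?_ ?_ ?_ ?_ <;>
    simp [heightOff_act_of_mem_parabolic b hJ hz,
      heightOff_act_of_mem_parabolic b hJ (inv_mem hz), act_inv_act, act_act_inv, invInd_mul]

theorem rhoPairing_act_of_mem_parabolic (b : P.Base) {J : Set ι} (hJ : J ⊆ b.support)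
    {z : P.weylGroup} (hz : z ∈ parabolic P J) (γ : ι) :
    rhoPairing b J (act z γ) = rhoPairing b J γ := by
  refine Finset.sum_nbij' (act z⁻¹) (act z) ?_ ?_ ?_ ?_ ?_ <;>
    simp [heightOff_act_of_mem_parabolic b hJ hz,
      heightOff_act_of_mem_parabolic b hJ (inv_mem hz), act_inv_act, act_act_inv,
      pairingIn_act_right]

theorem lenOff_empty_eq_add (b : P.Base) (J : Set ι) (u : P.weylGroup) :
    lenOff b ∅ u = lenOff b J u +
      ∑ β with 0 < heightOff b ∅ β ∧ heightOff b J β = 0, invInd b u β := by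
  unfold lenOff
  rw [← Finset.sum_filter_add_sum_filter_not _ (fun β ↦ 0 < heightOff b J β),
    Finset.filter_filter, Finset.filter_filter]
  congr 1
  · refine Finset.sum_congr (Finset.filter_congr fun β _ ↦ ?_) fun _ _ ↦ rfl
    exact ⟨And.right, fun h ↦ ⟨heightOff_empty_pos_of_pos b J h, h⟩⟩
  · refine Finset.sum_congr (Finset.filter_congr fun β _ ↦ ?_) fun _ _ ↦ rfl
    refine and_congr_right fun h ↦ ?_
    have := heightOff_nonneg b J h
    omega

theorem lenOff_le_lenOff_empty (b : P.Base) (J : Set ι) (u : P.weylGroup) :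
    lenOff b J u ≤ lenOff b ∅ u := by
  have : 0 ≤ ∑ β with 0 < heightOff b ∅ β ∧ heightOff b J β = 0, invInd b u β :=
    Finset.sum_nonneg fun β _ ↦ by unfold invInd; split_ifs <;> norm_num
  have := lenOff_empty_eq_add b J u
  omega

theorem lenOff_empty_eq_iff (b : P.Base) (J : Set ι) (u : P.weylGroup) :
    lenOff b ∅ u = lenOff b J u ↔
      ∀ β, 0 < heightOff b ∅ β → heightOff b J β = 0 → 0 < heightOff b ∅ (act u β) := by
  rw [lenOff_empty_eq_add b J u, add_eq_left, Finset.sum_eq_zero_iff_of_nonneg fun β _ ↦ by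
    unfold invInd; split_ifs <;> norm_num]
  simp only [Finset.mem_filter, Finset.mem_univ, true_and, and_imp]
  refine forall_congr' fun β ↦ imp_congr_right fun _ ↦ imp_congr_right fun _ ↦ ?_
  rcases invInd_cases b u β with ⟨h1, h2⟩ | ⟨h1, h2⟩ <;> simp [h2] <;> omega

variable [P.IsReduced]

/-- Minimality means that there are no inversions inside Φ_J. It suffices to test the simple roots
in J, as positive roots of Φ_J are their nonnegative combinations. -/
theorem mem_minReps_iff (b : P.Base) {J : Set ι} (hJ : J ⊆ b.support) (w : P.weylGroup) :
    w ∈ minReps b J ↔ lenOff b ∅ w = lenOff b J w := by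
  constructor
  · intro hw
    have hsimple : ∀ j ∈ J, 0 < heightOff b ∅ (act w j) := by
      intro j hj
      by_contra hn
      have h1 : length b w ≤ length b (w * refl P j) :=
        hw _ (Subgroup.subset_closure ⟨j, hj, rfl⟩)
      have h2 := length_eq_lenOff b w
      have h3 := length_eq_lenOff b (w * refl P j)
      have h4 := lenOff_refl_of_neg b ∅ (u := w) (γ := j)
        (by rw [heightOff_simple b ∅ (hJ hj)]; simp)
        (lt_of_le_of_ne (not_lt.1 hn) (heightOff_empty_ne_zero b _))
      omega
    rw [lenOff_empty_eq_iff]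
    intro β h1 h2
    obtain ⟨f, hf0, hfJ, hf⟩ := exists_nonneg_sum_of_heightOff_eq_zero b J h1 h2
    refine lt_of_le_of_ne ?_ (heightOff_empty_ne_zero b _).symm
    have e : heightOff b ∅ (act w β) = ∑ j ∈ b.support, f j * heightOff b ∅ (act w j) := by
      apply Int.cast_injective (α := K)
      push_cast
      simp only [cast_heightOff, root_act_eq, hf, map_sum, map_zsmul, zsmul_eq_mul]
    rw [e]
    refine Finset.sum_nonneg fun j hj ↦ ?_
    by_cases hjJ : j ∈ J
    · exact mul_nonneg (hf0 j) (hsimple j hjJ).le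
    · rw [hfJ j hj hjJ, zero_mul]
  · intro h u hu
    have h1 := lenOff_mul_of_mem_parabolic b hJ w hu
    have h2 := lenOff_le_lenOff_empty b J (w * u)
    have h3 := length_eq_lenOff b w
    have h4 := length_eq_lenOff b (w * u)
    omega

theorem floorRep_mem_minReps (b : P.Base) (J : Set ι) (u : P.weylGroup) :
    floorRep b J u ∈ minReps b J := by
  intro z hz
  apply length_floorRep_le
  rw [← mul_assoc]
  exact mul_mem (floorRep_mem b J u) hz

theorem exists_floorRep_eq (b : P.Base) (J : Set ι) (u : P.weylGroup) :
    ∃ z ∈ parabolic P J, floorRep b J u = u * z :=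
  ⟨_, floorRep_mem b J u, by rw [mul_inv_cancel_left]⟩

theorem length_floorRep (b : P.Base) {J : Set ι} (hJ : J ⊆ b.support) (u : P.weylGroup) :
    (length b (floorRep b J u) : ℤ) = lenOff b J u := by
  rw [length_eq_lenOff, (mem_minReps_iff b hJ _).1 (floorRep_mem_minReps b J u)]
  obtain ⟨z, hz, h⟩ := exists_floorRep_eq b J u
  rw [h, lenOff_mul_of_mem_parabolic b hJ u hz]

theorem floorRep_mul_of_mem_parabolic (b : P.Base) (J : Set ι) (u : P.weylGroup)
    {z : P.weylGroup} (hz : z ∈ parabolic P J) : floorRep b J (u * z) = floorRep b J u := by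
  have h : leftCoset J (u * z) = leftCoset J u := by
    ext x
    simp only [leftCoset, Set.mem_ofPred_eq, mul_inv_rev, mul_assoc]
    exact Subgroup.mul_mem_cancel_left _ (inv_mem hz)
  unfold floorRep
  congr 1

theorem eq_one_of_lenOff_eq_zero (b : P.Base) {z : P.weylGroup} (h : lenOff b ∅ z = 0) :
    z = 1 := by
  obtain ⟨l, hl, hn⟩ := exists_isWord_length_eq b z
  have := length_eq_lenOff b z
  obtain rfl : l = [] := List.length_eq_zero_iff.1 (by omega)
  simpa using hl.2.symm

/-- Uniqueness of minimal representatives: if w and wz both keep Φ_J^+ positive and z is in W_J,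
then z has no inversions. -/
theorem floorRep_eq_self (b : P.Base) {J : Set ι} (hJ : J ⊆ b.support) {w : P.weylGroup}
    (hw : w ∈ minReps b J) : floorRep b J w = w := by
  obtain ⟨z, hz, h⟩ := exists_floorRep_eq b J w
  have hw' := floorRep_mem_minReps b J w
  rw [h, mem_minReps_iff b hJ, lenOff_empty_eq_iff] at hw'
  rw [mem_minReps_iff b hJ, lenOff_empty_eq_iff] at hw
  suffices z = 1 by rw [h, this, mul_one]
  apply eq_one_of_lenOff_eq_zero b
  refine Finset.sum_eq_zero fun β hβ ↦ ?_
  have hβ : 0 < heightOff b ∅ β := (Finset.mem_filter.1 hβ).2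
  have e := heightOff_act_of_mem_parabolic b hJ hz β
  apply invInd_of_pos
  rcases (heightOff_nonneg b J hβ).lt_or_eq with h0 | h0
  · exact heightOff_empty_pos_of_pos b J (by omega)
  · by_contra hn
    have h1 := heightOff_empty_ne_zero b (act z β)
    have h2 := hw (neg P (act z β)) (by rw [heightOff_neg]; omega) (by rw [heightOff_neg]; omega)
    have h3 := hw' β hβ h0.symm
    rw [act_neg, heightOff_neg, ← act_mul] at h2
    omega

end Parabolic

/-! ### Both edge conditions as one equation on inversion counts. -/

section Edges

variable [Fintype ι] [CharZero K] [P.IsRootSystem] [P.IsCrystallographic]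

/-- `0` for Bruhat edges and `1` for quantum edges. -/
def EdgeType.toInt : EdgeType → ℤ
  | .bruhat => 0
  | .quantum => 1

/-- The length condition on edges in terms of cosets. -/
def LenCond (b : P.Base) (J : Set ι) (u : P.weylGroup) (γ : ι) (t : EdgeType) : Prop :=
  lenOff b J (u * refl P γ) - lenOff b J u = 1 - t.toInt * rhoPairing b J γ

theorem LenCond.invInd_eq {b : P.Base} {J : Set ι} {u : P.weylGroup} {γ : ι} {t : EdgeType}
    (h : LenCond b J u γ t) (hγ : 0 < heightOff b J γ) : invInd b u γ = t.toInt := by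
  have hc := two_le_rhoPairing b J hγ
  unfold LenCond at h
  rcases invInd_cases b u γ with ⟨h1, h2⟩ | ⟨h1, h2⟩
  · have := lenOff_refl_of_pos b J hγ h1
    cases t <;> simp only [EdgeType.toInt] at h ⊢ <;> omega
  · have := lenOff_refl_of_neg b J hγ h1
    cases t <;> simp only [EdgeType.toInt] at h ⊢ <;> omega

/-- 2ρ - 2ρ_J is the sum of the roots in Φ^+ \ Φ_J. -/
theorem coroot'_two_rho_sub (b : P.Base) {J : Set ι} (hJ : J ⊆ b.support) (γ : ι) :
    P.coroot' γ ((2 : K) • rho b - (2 : K) • rhoPar b J) = rhoPairing b J γ := by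
  have h1 : (2 : K) • rho b = ∑ β with 0 < heightOff b ∅ β, P.root β := by
    rw [rho, smul_smul, mul_one_div_cancel two_ne_zero, one_smul, finsum_mem_eq_toFinset_sum]
    refine Finset.sum_congr ?_ fun _ _ ↦ rfl
    ext β
    simp [mem_posRoots_iff]
  have h2 : (2 : K) • rhoPar b J =
      ∑ β with 0 < heightOff b ∅ β ∧ heightOff b J β = 0, P.root β := by
    rw [rhoPar, smul_smul, mul_one_div_cancel two_ne_zero, one_smul, finsum_mem_eq_toFinset_sum]
    refine Finset.sum_congr ?_ fun _ _ ↦ rfl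
    ext β
    simp [mem_posRoots_iff, mem_parabolicRoots_iff b hJ]
  have h3 : ∑ β with 0 < heightOff b ∅ β, P.root β = ∑ β with 0 < heightOff b J β, P.root β +
      ∑ β with 0 < heightOff b ∅ β ∧ heightOff b J β = 0, P.root β := by
    rw [← Finset.sum_filter_add_sum_filter_not _ (fun β ↦ 0 < heightOff b J β),
      Finset.filter_filter, Finset.filter_filter]
    congr 1
    · refine Finset.sum_congr (Finset.filter_congr fun β _ ↦ ?_) fun _ _ ↦ rfl
      exact ⟨And.right, fun h ↦ ⟨heightOff_empty_pos_of_pos b J h, h⟩⟩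
    · refine Finset.sum_congr (Finset.filter_congr fun β _ ↦ ?_) fun _ _ ↦ rfl
      refine and_congr_right fun h ↦ ?_
      have := heightOff_nonneg b J h
      omega
  rw [h1, h2, h3, add_sub_cancel_right, map_sum, rhoPairing, Int.cast_sum]
  simp only [P.root_coroot'_eq_pairing, pairing_eq_cast]

variable [P.IsReduced]

/-- If w r_γ made some β in Φ_J^+ negative, then -r_γ β would be a second root of `reflInv`
contributing 1 besides γ, and the count would rise by at least 2. -/
theorem LenCond.mul_refl_mem_minReps {b : P.Base} {J : Set ι} (hJ : J ⊆ b.support)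
    {w : P.weylGroup} (hw : w ∈ minReps b J) {γ : ι} (hγ : 0 < heightOff b J γ)
    (h : LenCond b J w γ .bruhat) : w * refl P γ ∈ minReps b J := by
  have hwγ : 0 < heightOff b ∅ (act w γ) := by
    have := h.invInd_eq hγ
    simp only [EdgeType.toInt] at this
    rcases invInd_cases b w γ with ⟨h1, h2⟩ | ⟨h1, h2⟩ <;> omega
  rw [mem_minReps_iff b hJ, lenOff_empty_eq_iff] at hw ⊢
  intro β h1 h2
  by_contra hn
  have hwβ := hw β h1 h2
  rw [act_mul, heightOff_act_act_refl] at hn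
  have hk : 0 < P.pairingIn ℤ β γ := by
    by_contra hk
    have := mul_nonneg (a := -P.pairingIn ℤ β γ) (by omega) hwγ.le
    rw [neg_mul] at this
    omega
  have hδ1 : 0 < heightOff b J (neg P (act (refl P γ) β)) := by
    rw [heightOff_neg, heightOff_act_refl, h2]
    have := mul_pos hk hγ
    omega
  have hδ2 : act (refl P γ) (neg P (act (refl P γ) β)) = neg P β := by
    rw [act_neg, act_refl_refl]
  have hδ3 : neg P (act (refl P γ) β) ∈ reflInv b J γ := by
    simp only [reflInv, Finset.mem_filter, Finset.mem_univ, true_and]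
    refine ⟨hδ1, ?_⟩
    rw [hδ2, heightOff_neg]; omega
  have hne : γ ≠ neg P (act (refl P γ) β) := by
    intro he
    rw [← he, act_refl_self] at hδ2
    have := congrArg (heightOff b J) hδ2
    rw [heightOff_neg, heightOff_neg] at this
    omega
  have hsum := Finset.sum_le_sum_of_subset_of_nonneg (f := fun β ↦
      invInd b w (act (refl P γ) β) - invInd b w β)
    (Finset.insert_subset (self_mem_reflInv b J hγ) (Finset.singleton_subset_iff.2 hδ3))
    fun β hβ _ ↦ (invInd_diff_of_pos b J hγ hwγ hβ).1
  rw [Finset.sum_pair hne, ← lenOff_refl_sub, h, hδ2, invInd_refl_self,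
    invInd_of_pos b hwγ, invInd_of_neg b (β := neg P β) (by rw [act_neg, heightOff_neg]; omega),
    invInd_of_pos b (β := neg P (act (refl P γ) β)) (by
      have h3 := heightOff_empty_ne_zero b (act w (act (refl P γ) β))
      rw [act_neg, heightOff_neg]
      rw [heightOff_act_act_refl] at h3 ⊢
      omega)] at hsum
  simp [EdgeType.toInt] at hsum

theorem edgeCondition_iff (b : P.Base) {J : Set ι} (hJ : J ⊆ b.support) {w : P.weylGroup}
    (hw : w ∈ minReps b J) {γ : ι} (hγ : 0 < heightOff b J γ) (t : EdgeType) :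
    EdgeCondition b J w γ t ↔ LenCond b J w γ t := by
  have hlw := length_eq_lenOff b w
  have hwe := (mem_minReps_iff b hJ w).1 hw
  cases t with
  | bruhat =>
    have hlr := length_eq_lenOff b (w * refl P γ)
    rw [EdgeCondition, bruhatCovBy_iff]
    constructor
    · intro h
      have h1 : 0 < heightOff b ∅ (act w γ) := by
        by_contra hn
        have := lenOff_refl_of_neg b ∅ (heightOff_empty_pos_of_pos b J hγ)
          (lt_of_le_of_ne (not_lt.1 hn) (heightOff_empty_ne_zero b _))
        omega
      have h2 := lenOff_refl_of_pos b J hγ h1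
      -- The count outside Φ_J rises by at least 1, and by at most the full length change, which is
      -- 1.
      have h3 := lenOff_le_lenOff_empty b J (w * refl P γ)
      simp only [LenCond, EdgeType.toInt]
      omega
    · intro h
      have h1 := (mem_minReps_iff b hJ _).1 (h.mul_refl_mem_minReps hJ hw hγ)
      simp only [LenCond, EdgeType.toInt] at h
      omega
  | quantum =>
    have hlf := length_floorRep b hJ (w * refl P γ)
    rw [EdgeCondition, coroot'_two_rho_sub b hJ]
    simp only [LenCond, EdgeType.toInt]
    rw [← hlf, ← hwe, ← hlw]
    constructor
    · intro h
      have : (length b (floorRep b J (w * refl P γ)) : ℤ) =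
          length b w + 1 - rhoPairing b J γ := by
        apply Int.cast_injective (α := K); push_cast; exact h
      omega
    · intro h
      have : (length b (floorRep b J (w * refl P γ)) : ℤ) =
          length b w + 1 - rhoPairing b J γ := by omega
      exact_mod_cast congrArg (Int.cast (R := K)) this

theorem edge_iff (b : P.Base) {J : Set ι} (hJ : J ⊆ b.support) (t : EdgeType)
    (w : P.weylGroup) (γ : ι) (v : P.weylGroup) :
    Edge b J t w γ v ↔ w ∈ minReps b J ∧ 0 < heightOff b J γ ∧
      v = floorRep b J (w * refl P γ) ∧ LenCond b J w γ t := by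
  constructor
  · rintro ⟨h1, h2, h3, h4⟩
    rw [mem_label_iff b hJ] at h2
    exact ⟨h1, h2, h3, (edgeCondition_iff b hJ h1 h2 t).1 h4⟩
  · rintro ⟨h1, h2, h3, h4⟩
    exact ⟨h1, (mem_label_iff b hJ γ).2 h2, h3, (edgeCondition_iff b hJ h1 h2 t).2 h4⟩

end Edges

/-! ### The diamond argument, common to simple roots and -θ. -/

section Diamond

variable [Fintype ι] [CharZero K] [P.IsRootSystem] [P.IsCrystallographic]

/-- How left multiplication by `r_α` changes the signs of roots, with `χ` as in
`IsAffineSimple`. -/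
def ShiftsSigns (b : P.Base) (α : ι) (χ : ℤ) : Prop :=
  ∀ (u : P.weylGroup) (γ : ι), γ ≠ act u⁻¹ α → γ ≠ neg P (act u⁻¹ α) →
    invInd b (refl P α * u) γ = invInd b u γ - χ * P.pairingIn ℤ γ (act u⁻¹ α)

theorem act_ne_of_ne_inv {u : P.weylGroup} {γ α : ι} (h : γ ≠ act u⁻¹ α) : act u γ ≠ α := by
  rintro rfl
  exact h (act_inv_act u γ).symm

theorem pairingIn_act_inv (u : P.weylGroup) (γ α : ι) :
    P.pairingIn ℤ γ (act u⁻¹ α) = P.pairingIn ℤ (act u γ) α := by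
  rw [pairingIn_act_right, inv_inv]

theorem shiftsSigns_simple [P.IsReduced] (b : P.Base) {α : ι} (hα : α ∈ b.support) :
    ShiftsSigns b α 0 := by
  intro u γ h1 h2
  rw [zero_mul, sub_zero]
  have h1' := act_ne_of_ne_inv h1
  rw [← act_neg] at h2
  have h2' := act_ne_of_ne_inv h2
  have e : act (refl P α * u) γ = act (refl P α) (act u γ) := act_mul _ _ _
  rcases invInd_cases b u γ with ⟨h3, h4⟩ | ⟨h3, h4⟩
  · rw [h4, invInd_of_pos]
    rw [e]
    exact height_pos_act_simple b hα h3 h1'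
  · rw [h4, invInd_of_neg]
    have := height_pos_act_simple b hα (β := neg P (act u γ)) (by rw [heightOff_neg]; omega)
      (fun h ↦ h2' (by rw [← h, neg_neg]))
    rw [act_neg, heightOff_neg, ← e] at this
    omega

/-- For uγ ≠ ±θ the pairing with θ^∨ is -1, 0 or 1. A nonzero value fixes the sign of uγ, and r_θ
reverses it; at 0, r_θ fixes uγ. -/
theorem shiftsSigns_neg_highestRoot (b : P.Base) {θ : ι} (hθ : IsHighestRoot b θ) :
    ShiftsSigns b (neg P θ) 1 := by
  intro u γ h1 h2
  have h1' := act_ne_of_ne_inv h1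
  rw [act_neg, neg_neg] at h2
  have h2' := act_ne_of_ne_inv h2
  rw [refl_neg, one_mul, pairingIn_act_inv, pairingIn_neg_right]
  have e : act (refl P θ * u) γ = act (refl P θ) (act u γ) := act_mul _ _ _
  have k1 := hθ.pairingIn_le_one h2'
  have k2 := hθ.pairingIn_le_one (β := neg P (act u γ)) fun h ↦ h1' (by rw [← h, neg_neg])
  rw [pairingIn_neg_left] at k2
  have e2 : P.pairingIn ℤ (act (refl P θ) (act u γ)) θ = -P.pairingIn ℤ (act u γ) θ := by
    rw [pairingIn_act_refl, RootPairing.pairingIn_same]; ring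
  rcases lt_trichotomy (P.pairingIn ℤ (act u γ) θ) 0 with h | h | h
  · have h3 := hθ.height_pos (β := neg P (act u γ)) (by rw [pairingIn_neg_left]; omega)
    have h4 := hθ.height_pos (β := act (refl P θ) (act u γ)) (by omega)
    rw [heightOff_neg] at h3
    rw [invInd_of_neg b (u := u) (by omega), invInd_of_pos b (by rwa [e])]
    omega
  · have : act (refl P θ * u) γ = act u γ := by
      apply P.root.injective
      rw [e, root_act_refl, h]
      simp
    simp only [invInd, this, h]
    ring
  · have h3 := hθ.height_pos (β := neg P (act (refl P θ) (act u γ)))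
      (by rw [pairingIn_neg_left]; omega)
    have h4 := hθ.height_pos (β := act u γ) (by omega)
    rw [heightOff_neg, ← e] at h3
    rw [invInd_of_pos b (u := u) h4, invInd_of_neg b (by omega)]
    omega

theorem IsAffineSimple.lenOff_diff {b : P.Base} {J : Set ι} {α : ι} {χ : ℤ}
    (hα : IsAffineSimple b J α χ) (u : P.weylGroup) (γ : ι) :
    lenOff b J (refl P α * u * refl P γ) - lenOff b J (refl P α * u) =
      lenOff b J (u * refl P γ) - lenOff b J u +
        (heightOff b J (act (refl P γ) (act u⁻¹ α))).sign - (heightOff b J (act u⁻¹ α)).sign +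
        χ * P.pairingIn ℤ γ (act u⁻¹ α) * rhoPairing b J γ := by
  have h1 := hα.lenOff_refl_mul u
  have h2 := hα.lenOff_refl_mul (u * refl P γ)
  rw [mul_inv_rev, refl_inv, act_mul, rhoPairing_act_refl, ← mul_assoc] at h2
  linear_combination h2 - h1

/-- The lower bounds 1 and 1 - c(γ) on the left side both give sgn ≥ 1. This is what produces the
missing vertical edge. -/
theorem sign_eq_one_of_bounds {b : P.Base} {J : Set ι} {u : P.weylGroup} {γ : ι}
    (hγ : 0 < heightOff b J γ) {s : ℤ}
    (h : lenOff b J (u * refl P γ) - lenOff b J u = s.sign - invInd b u γ * rhoPairing b J γ) :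
    0 < s := by
  have : 0 < s.sign := by
    rcases invInd_cases b u γ with ⟨h1, h2⟩ | ⟨h1, h2⟩
    · have := lenOff_refl_of_pos b J hγ h1
      rw [h2] at h
      omega
    · have := lenOff_refl_of_neg b J hγ h1
      rw [h2] at h
      omega
  exact Int.sign_eq_one_iff_pos.1 (by have := Int.sign_trichotomy s; omega)

theorem exists_toInt_eq (b : P.Base) (u : P.weylGroup) (γ : ι) :
    ∃ t : EdgeType, t.toInt = invInd b u γ := by
  rcases invInd_cases b u γ with ⟨-, h⟩ | ⟨-, h⟩
  · exact ⟨.bruhat, h.symm⟩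
  · exact ⟨.quantum, h.symm⟩

theorem diamond_up {b : P.Base} {J : Set ι} {α : ι} {χ : ℤ} (hα : IsAffineSimple b J α χ)
    (hs : ShiftsSigns b α χ) {u : P.weylGroup} {γ : ι} (hγ : 0 < heightOff b J γ)
    (h1 : γ ≠ act u⁻¹ α) (h2 : γ ≠ neg P (act u⁻¹ α)) {t : EdgeType}
    (hη : 0 < heightOff b J (act u⁻¹ α)) (ht : LenCond b J u γ t) :
    0 < heightOff b J (act (refl P γ) (act u⁻¹ α)) ∧
      ∃ t' : EdgeType, t'.toInt = t.toInt - χ * P.pairingIn ℤ γ (act u⁻¹ α) ∧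
        LenCond b J (refl P α * u) γ t' := by
  have h3 := hs u γ h1 h2
  have h4 := hα.lenOff_diff u γ
  rw [Int.sign_eq_one_of_pos hη, ht, ← ht.invInd_eq hγ] at h4
  have h5 : 0 < heightOff b J (act (refl P γ) (act u⁻¹ α)) := by
    refine sign_eq_one_of_bounds hγ (u := refl P α * u) ?_
    rw [h4, h3]; ring
  obtain ⟨t', ht'⟩ := exists_toInt_eq b (refl P α * u) γ
  refine ⟨h5, t', by rw [ht', h3, ht.invInd_eq hγ], ?_⟩
  rw [LenCond, h4, Int.sign_eq_one_of_pos h5, ht', h3]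
  ring

theorem diamond_down {b : P.Base} {J : Set ι} {α : ι} {χ : ℤ} (hα : IsAffineSimple b J α χ)
    (hs : ShiftsSigns b α χ) {u : P.weylGroup} {γ : ι} (hγ : 0 < heightOff b J γ)
    (h1 : γ ≠ act u⁻¹ α) (h2 : γ ≠ neg P (act u⁻¹ α)) {t : EdgeType}
    (hη : 0 < heightOff b J (act (refl P γ) (act u⁻¹ α)))
    (ht : LenCond b J (refl P α * u) γ t) :
    0 < heightOff b J (act u⁻¹ α) ∧
      ∃ t' : EdgeType, t'.toInt = t.toInt + χ * P.pairingIn ℤ γ (act u⁻¹ α) ∧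
        LenCond b J u γ t' := by
  have h3 := hs u γ h1 h2
  have h4 := hα.lenOff_diff u γ
  rw [Int.sign_eq_one_of_pos hη, ht, ← ht.invInd_eq hγ, h3] at h4
  have h5 : 0 < heightOff b J (act u⁻¹ α) := by
    refine sign_eq_one_of_bounds hγ (u := u) ?_
    linear_combination -h4
  obtain ⟨t', ht'⟩ := exists_toInt_eq b u γ
  refine ⟨h5, t', by rw [ht', ← ht.invInd_eq hγ, h3]; ring, ?_⟩
  rw [LenCond, ht']
  rw [Int.sign_eq_one_of_pos h5] at h4
  linear_combination -h4

end Diamond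

/-! ### Translating the diamonds back to edges of QB(W^J). -/

section EdgePairs

variable [Fintype ι] [CharZero K] [P.IsRootSystem] [P.IsCrystallographic] [P.IsReduced]
  {b : P.Base} {J : Set ι} {w : P.weylGroup} {γ : ι}

theorem heightOff_act_floorRep_inv (hJ : J ⊆ b.support) (u : P.weylGroup) (β : ι) :
    heightOff b J (act (floorRep b J u)⁻¹ β) = heightOff b J (act u⁻¹ β) := by
  obtain ⟨z, hz, h⟩ := exists_floorRep_eq b J u
  rw [h, mul_inv_rev, act_mul, heightOff_act_of_mem_parabolic b hJ (inv_mem hz)]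

theorem floorRep_mul_floorRep (x u : P.weylGroup) :
    floorRep b J (x * floorRep b J u) = floorRep b J (x * u) := by
  obtain ⟨z, hz, h⟩ := exists_floorRep_eq b J u
  rw [h, ← mul_assoc, floorRep_mul_of_mem_parabolic b J _ hz]

/-- A vertical Bruhat edge for a simple root `α`. -/
theorem edge_simple_iff (hJ : J ⊆ b.support) {α : ι} (hα : α ∈ b.support)
    (hw : w ∈ minReps b J) :
    Edge b J .bruhat w (act w⁻¹ α) (refl P α * w) ↔ 0 < heightOff b J (act w⁻¹ α) := by
  rw [edge_iff b hJ, ← refl_mul_eq]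
  refine ⟨fun h ↦ h.2.1, fun h ↦ ?_⟩
  have hc : LenCond b J w (act w⁻¹ α) .bruhat :=
    isAffineSimple_simple b J hα w _ h (act_act_inv w α)
  refine ⟨hw, h, ?_, hc⟩
  have := hc.mul_refl_mem_minReps hJ hw h
  rw [← refl_mul_eq] at this
  rw [floorRep_eq_self b hJ this]

theorem simple_mul_mem_minReps (hJ : J ⊆ b.support) {α : ι} (hα : α ∈ b.support)
    (hw : w ∈ minReps b J) (h : 0 < heightOff b J (act w⁻¹ α)) :
    refl P α * w ∈ minReps b J := by
  rw [((edge_iff b hJ _ _ _ _).1 ((edge_simple_iff hJ hα hw).2 h)).2.2.1]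
  exact floorRep_mem_minReps b J _

/-- A vertical quantum edge for the highest root `θ`. -/
theorem edge_highestRoot_iff (hJ : J ⊆ b.support) {θ : ι} (hθ : IsHighestRoot b θ)
    (hw : w ∈ minReps b J) :
    Edge b J .quantum w (neg P (act w⁻¹ θ)) (floorRep b J (refl P θ * w)) ↔
      0 < heightOff b J (act w⁻¹ (neg P θ)) := by
  rw [edge_iff b hJ, refl_neg, ← refl_mul_eq, ← act_neg]
  exact ⟨fun h ↦ h.2.1, fun h ↦ ⟨hw, h, rfl,
    isAffineSimple_neg_highestRoot b J hθ w _ h (act_act_inv w _)⟩⟩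

theorem edge_floorRep_iff (hJ : J ⊆ b.support) (hw : w ∈ minReps b J)
    (hγ : 0 < heightOff b J γ) (t : EdgeType) :
    Edge b J t w γ (floorRep b J (w * refl P γ)) ↔ LenCond b J w γ t := by
  rw [edge_iff b hJ]
  exact ⟨fun h ↦ h.2.2.2, fun h ↦ ⟨hw, hγ, rfl, h⟩⟩

theorem simpleBottom_iff (hJ : J ⊆ b.support) (hw : w ∈ minReps b J)
    (hγ : 0 < heightOff b J γ) {α : ι} (hα : α ∈ b.support) (t : EdgeType) :
    SimpleBottom b J w γ α t ↔ 0 < heightOff b J (act w⁻¹ α) ∧ LenCond b J w γ t := by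
  rw [SimpleBottom, edge_simple_iff hJ hα hw, edge_floorRep_iff hJ hw hγ]

theorem heightOff_act_floorRep_mul_refl_inv (hJ : J ⊆ b.support) (α : ι) :
    heightOff b J (act (floorRep b J (w * refl P γ))⁻¹ α) =
      heightOff b J (act (refl P γ) (act w⁻¹ α)) := by
  rw [heightOff_act_floorRep_inv hJ, mul_inv_rev, refl_inv, act_mul]

theorem SimpleTop.conditions (hJ : J ⊆ b.support) {α : ι} (hα : α ∈ b.support) {t : EdgeType}
    (h : SimpleTop b J w γ α t) :
    0 < heightOff b J (act (refl P γ) (act w⁻¹ α)) ∧ LenCond b J (refl P α * w) γ t := by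
  obtain ⟨h1, h2⟩ := h
  rw [edge_simple_iff hJ hα (floorRep_mem_minReps b J _),
    heightOff_act_floorRep_mul_refl_inv hJ] at h2
  exact ⟨h2, ((edge_iff b hJ _ _ _ _).1 h1).2.2.2⟩

theorem SimpleTop.refl_mul_floorRep {α : ι} {t : EdgeType} (h : SimpleTop b J w γ α t) :
    refl P α * floorRep b J (w * refl P γ) = floorRep b J (refl P α * w * refl P γ) :=
  h.1.target_eq

theorem simpleTop_of_conditions (hJ : J ⊆ b.support) (hw : w ∈ minReps b J)
    (hγ : 0 < heightOff b J γ) {α : ι} (hα : α ∈ b.support) {t : EdgeType}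
    (h1 : 0 < heightOff b J (act w⁻¹ α))
    (h2 : 0 < heightOff b J (act (refl P γ) (act w⁻¹ α)))
    (h3 : LenCond b J (refl P α * w) γ t) : SimpleTop b J w γ α t := by
  have hv := floorRep_mem_minReps b J (w * refl P γ)
  rw [← heightOff_act_floorRep_mul_refl_inv hJ] at h2
  refine ⟨(edge_iff b hJ _ _ _ _).2 ⟨simple_mul_mem_minReps hJ hα hw h1, hγ, ?_, h3⟩,
    (edge_simple_iff hJ hα hv).2 h2⟩
  -- The element r_α v is already minimal in its coset, so it may be replaced by its own floor.
  rw [← floorRep_eq_self b hJ (simple_mul_mem_minReps hJ hα hv h2), floorRep_mul_floorRep,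
    mul_assoc]

theorem SimpleBottom.top (hJ : J ⊆ b.support) (hw : w ∈ minReps b J)
    (hγ : 0 < heightOff b J γ) {α : ι} (hα : α ∈ b.support) {t : EdgeType}
    (hne : γ ≠ act w⁻¹ α) (h : SimpleBottom b J w γ α t) : SimpleTop b J w γ α t := by
  obtain ⟨h1, h2⟩ := (simpleBottom_iff hJ hw hγ hα t).1 h
  -- The case γ = -w⁻¹α is void, since γ and w⁻¹α both have positive height off J.
  obtain ⟨h3, t', ht', h4⟩ := diamond_up (isAffineSimple_simple b J hα)
    (shiftsSigns_simple b hα) hγ hne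
    (by intro h; rw [h, heightOff_neg] at hγ; omega) h1 h2
  obtain rfl : t' = t := by
    cases t <;> cases t' <;> simp [EdgeType.toInt] at ht' ⊢
  exact simpleTop_of_conditions hJ hw hγ hα h1 h3 h4

theorem SimpleTop.bottom (hJ : J ⊆ b.support) (hw : w ∈ minReps b J)
    (hγ : 0 < heightOff b J γ) {α : ι} (hα : α ∈ b.support) {t : EdgeType}
    (hne : γ ≠ neg P (act w⁻¹ α)) (h : SimpleTop b J w γ α t) : SimpleBottom b J w γ α t := by
  obtain ⟨h1, h2⟩ := h.conditions hJ hα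
  obtain ⟨h3, t', ht', h4⟩ := diamond_down (isAffineSimple_simple b J hα)
    (shiftsSigns_simple b hα) hγ
    (by rintro rfl; rw [act_refl_self, heightOff_neg] at h1; omega) hne h1 h2
  obtain rfl : t' = t := by
    cases t <;> cases t' <;> simp [EdgeType.toInt] at ht' ⊢
  exact (simpleBottom_iff hJ hw hγ hα _).2 ⟨h3, h4⟩

theorem LenCond.quantum_neg (hγ : 0 < heightOff b J γ) (h : LenCond b J w γ .quantum) :
    heightOff b ∅ (act w γ) < 0 := by
  have := h.invInd_eq hγ
  simp only [EdgeType.toInt] at this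
  rcases invInd_cases b w γ with ⟨h1, h2⟩ | ⟨h1, h2⟩ <;> omega

theorem LenCond.bruhat_pos (hγ : 0 < heightOff b J γ) (h : LenCond b J w γ .bruhat) :
    0 < heightOff b ∅ (act w γ) := by
  have := h.invInd_eq hγ
  simp only [EdgeType.toInt] at this
  rcases invInd_cases b w γ with ⟨h1, h2⟩ | ⟨h1, h2⟩ <;> omega

/-- A quantum edge needs wγ negative, whereas w(w⁻¹α) = α is positive. -/
theorem SimpleBottom.ne_of_quantum (hJ : J ⊆ b.support) (hw : w ∈ minReps b J)
    (hγ : 0 < heightOff b J γ) {α : ι} (hα : α ∈ b.support)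
    (h : SimpleBottom b J w γ α .quantum) : γ ≠ act w⁻¹ α := by
  rintro rfl
  have := ((simpleBottom_iff hJ hw hγ hα _).1 h).2.quantum_neg hγ
  rw [act_act_inv, heightOff_simple b ∅ hα] at this
  simp at this

theorem SimpleTop.ne_of_quantum (hJ : J ⊆ b.support)
    (hγ : 0 < heightOff b J γ) {α : ι} (hα : α ∈ b.support)
    (h : SimpleTop b J w γ α .quantum) : γ ≠ neg P (act w⁻¹ α) := by
  rintro rfl
  have := (h.conditions hJ hα).2.quantum_neg hγ
  rw [← act_neg, act_mul, act_act_inv, act_neg, act_refl_self, neg_neg,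
    heightOff_simple b ∅ hα] at this
  simp at this

theorem thetaBottom_iff (hJ : J ⊆ b.support) (hw : w ∈ minReps b J)
    (hγ : 0 < heightOff b J γ) {θ : ι} (hθ : IsHighestRoot b θ) (t : EdgeType) :
    ThetaBottom b J w γ θ t ↔
      0 < heightOff b J (act w⁻¹ (neg P θ)) ∧ LenCond b J w γ t := by
  rw [ThetaBottom, edge_highestRoot_iff hJ hθ hw, edge_floorRep_iff hJ hw hγ]

theorem lenCond_mul_inv_act_iff (hJ : J ⊆ b.support) (u : P.weylGroup) {z : P.weylGroup}
    (hz : z ∈ parabolic P J) (γ : ι) (t : EdgeType) :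
    LenCond b J (u * z⁻¹) (act z γ) t ↔ LenCond b J u γ t := by
  have h : u * z⁻¹ * refl P (act z γ) = u * refl P γ * z⁻¹ := by
    rw [mul_assoc, ← mul_inv_cancel_right (refl P (act z γ)) z, refl_act]
    group
  rw [LenCond, LenCond, h, lenOff_mul_of_mem_parabolic b hJ _ (inv_mem hz),
    lenOff_mul_of_mem_parabolic b hJ _ (inv_mem hz), rhoPairing_act_of_mem_parabolic b hJ hz]

/-- Since ⌊r_θ w⌋ r_{zγ} = r_θ w r_γ z⁻¹ with z in W_J, the twist by z is invisible on cosets, and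
the upper edge can be tested at r_θ w with label γ. -/
theorem thetaTop_iff (hJ : J ⊆ b.support) (hγ : 0 < heightOff b J γ) {θ : ι}
    (hθ : IsHighestRoot b θ) {z : P.weylGroup}
    (hz : refl P θ * w = floorRep b J (refl P θ * w) * z) (t : EdgeType) :
    ThetaTop b J w γ θ z t ↔ 0 < heightOff b J (act (refl P γ) (act w⁻¹ (neg P θ))) ∧
      LenCond b J (refl P (neg P θ) * w) γ t := by
  have hzJ : z ∈ parabolic P J := by
    obtain ⟨y, hy, h⟩ := exists_floorRep_eq b J (refl P θ * w)
    have : y * z = 1 := by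
      rw [h, mul_assoc (refl P θ * w)] at hz
      exact left_eq_mul.1 hz
    rw [← inv_eq_of_mul_eq_one_right this]
    exact inv_mem hy
  have hf : floorRep b J (refl P θ * w) = refl P θ * w * z⁻¹ := eq_mul_inv_of_mul_eq hz.symm
  have hm := floorRep_mem_minReps b J (refl P θ * w)
  have h1 := edge_highestRoot_iff hJ hθ (floorRep_mem_minReps b J (w * refl P γ))
  rw [floorRep_mul_floorRep, heightOff_act_floorRep_mul_refl_inv hJ, ← mul_assoc] at h1
  rw [ThetaTop, h1, and_comm, edge_iff b hJ, refl_neg]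
  refine and_congr_right fun _ ↦ ?_
  have h2 : floorRep b J (refl P θ * w * refl P γ) =
      floorRep b J (floorRep b J (refl P θ * w) * refl P (act z γ)) := by
    rw [← floorRep_mul_of_mem_parabolic b J (_ * refl P (act z γ)) hzJ, mul_assoc _ _ z,
      refl_act, ← mul_assoc, ← hz]
  rw [heightOff_act_of_mem_parabolic b hJ hzJ]
  have h3 := lenCond_mul_inv_act_iff (b := b) hJ (refl P θ * w) hzJ γ t
  rw [← hf] at h3
  rw [h3]
  exact ⟨fun h ↦ h.2.2.2, fun h ↦ ⟨hm, hγ, h2, h⟩⟩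

theorem ThetaBottom.top (hJ : J ⊆ b.support) (hw : w ∈ minReps b J)
    (hγ : 0 < heightOff b J γ) {θ : ι} (hθ : IsHighestRoot b θ) {z : P.weylGroup}
    (hz : refl P θ * w = floorRep b J (refl P θ * w) * z) {t : EdgeType}
    (hne : γ ≠ neg P (act w⁻¹ θ)) (h : ThetaBottom b J w γ θ t) :
    ∃ t' : EdgeType, t'.toInt = t.toInt + P.pairingIn ℤ γ (act w⁻¹ θ) ∧
      ThetaTop b J w γ θ z t' := by
  obtain ⟨h1, h2⟩ := (thetaBottom_iff hJ hw hγ hθ t).1 h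
  obtain ⟨h3, t', ht', h4⟩ := diamond_up (isAffineSimple_neg_highestRoot b J hθ)
    (shiftsSigns_neg_highestRoot b hθ) hγ (by rwa [act_neg])
    (by intro h; rw [h, heightOff_neg] at hγ; omega) h1 h2
  rw [act_neg, pairingIn_neg_right] at ht'
  exact ⟨t', by rw [ht']; ring, (thetaTop_iff hJ hγ hθ hz t').2 ⟨h3, h4⟩⟩

theorem ThetaTop.bottom (hJ : J ⊆ b.support) (hw : w ∈ minReps b J)
    (hγ : 0 < heightOff b J γ) {θ : ι} (hθ : IsHighestRoot b θ) {z : P.weylGroup}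
    (hz : refl P θ * w = floorRep b J (refl P θ * w) * z) {t : EdgeType}
    (hne : γ ≠ act w⁻¹ θ) (h : ThetaTop b J w γ θ z t) :
    ∃ t' : EdgeType, t'.toInt = t.toInt - P.pairingIn ℤ γ (act w⁻¹ θ) ∧
      ThetaBottom b J w γ θ t' := by
  obtain ⟨h1, h2⟩ := (thetaTop_iff hJ hγ hθ hz t).1 h
  obtain ⟨h3, t', ht', h4⟩ := diamond_down (isAffineSimple_neg_highestRoot b J hθ)
    (shiftsSigns_neg_highestRoot b hθ) hγ
    (by rintro rfl; rw [act_refl_self, heightOff_neg] at h1; omega)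
    (by rwa [act_neg, neg_neg]) h1 h2
  rw [act_neg, pairingIn_neg_right] at ht'
  exact ⟨t', by rw [ht']; ring, (thetaBottom_iff hJ hw hγ hθ t').2 ⟨h3, h4⟩⟩

theorem ThetaBottom.ne_of_bruhat (hJ : J ⊆ b.support) (hw : w ∈ minReps b J)
    (hγ : 0 < heightOff b J γ) {θ : ι} (hθ : IsHighestRoot b θ)
    (h : ThetaBottom b J w γ θ .bruhat) : γ ≠ neg P (act w⁻¹ θ) := by
  rintro rfl
  have h1 := ((thetaBottom_iff hJ hw hγ hθ _).1 h).2.bruhat_pos hγ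
  rw [← act_neg, act_act_inv, heightOff_neg] at h1
  have := hθ.pos
  omega

theorem ThetaTop.ne_of_bruhat (hJ : J ⊆ b.support)
    (hγ : 0 < heightOff b J γ) {θ : ι} (hθ : IsHighestRoot b θ) {z : P.weylGroup}
    (hz : refl P θ * w = floorRep b J (refl P θ * w) * z)
    (h : ThetaTop b J w γ θ z .bruhat) : γ ≠ act w⁻¹ θ := by
  rintro rfl
  have h1 := ((thetaTop_iff hJ hγ hθ hz _).1 h).2.bruhat_pos hγ
  rw [act_mul, act_act_inv, refl_neg, act_refl_self, heightOff_neg] at h1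
  have := hθ.pos
  omega

theorem ThetaBottom.top_of_iff (hJ : J ⊆ b.support) (hw : w ∈ minReps b J)
    (hγ : 0 < heightOff b J γ) {θ : ι} (hθ : IsHighestRoot b θ) {z : P.weylGroup}
    (hz : refl P θ * w = floorRep b J (refl P θ * w) * z) {t : EdgeType}
    (hne : γ ≠ neg P (act w⁻¹ θ)) (h : ThetaBottom b J w γ θ t) (t' : EdgeType)
    (htt : t' = t ↔ P.pairingIn ℤ γ (act w⁻¹ θ) = 0) : ThetaTop b J w γ θ z t' := by
  obtain ⟨s, hs, h'⟩ := h.top hJ hw hγ hθ hz hne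
  -- Types are 0 or 1, so a nonzero pairing forces the opposite type and a zero pairing the same
  -- one.
  obtain rfl : s = t' := by
    cases t <;> cases t' <;> cases s <;> simp [EdgeType.toInt] at hs htt ⊢ <;> omega
  exact h'

theorem ThetaTop.bottom_of_iff (hJ : J ⊆ b.support) (hw : w ∈ minReps b J)
    (hγ : 0 < heightOff b J γ) {θ : ι} (hθ : IsHighestRoot b θ) {z : P.weylGroup}
    (hz : refl P θ * w = floorRep b J (refl P θ * w) * z) {t : EdgeType}
    (hne : γ ≠ act w⁻¹ θ) (h : ThetaTop b J w γ θ z t) (t' : EdgeType)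
    (htt : t' = t ↔ P.pairingIn ℤ γ (act w⁻¹ θ) = 0) : ThetaBottom b J w γ θ t' := by
  obtain ⟨s, hs, h'⟩ := h.bottom hJ hw hγ hθ hz hne
  obtain rfl : s = t' := by
    cases t <;> cases t' <;> cases s <;> simp [EdgeType.toInt] at hs htt ⊢ <;> omega
  exact h'

end EdgePairs

end PQBG

end

theorem mainTheorem8 {ι K M N : Type*} [Finite ι] [Field K] [CharZero K]
    [AddCommGroup M] [Module K M] [AddCommGroup N] [Module K N]
    (P : RootPairing ι K M N) [P.IsRootSystem] [P.IsCrystallographic] [P.IsReduced]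
    [P.IsIrreducible] (b : P.Base) (J : Set ι) (hJ : J ⊆ b.support)
    (w : P.weylGroup) (hw : w ∈ PQBG.minReps b J)
    (γ : ι) (hγ : γ ∈ PQBG.posRoots b \ PQBG.parabolicRoots P J) :
    -- the diamonds for a simple root `α`
    (∀ α ∈ b.support,
      -- left diagram
      (γ ≠ PQBG.act w⁻¹ α →
        PQBG.SimpleBottom b J w γ α .bruhat → PQBG.SimpleTop b J w γ α .bruhat) ∧
      (γ ≠ PQBG.neg P (PQBG.act w⁻¹ α) →
        PQBG.SimpleTop b J w γ α .bruhat → PQBG.SimpleBottom b J w γ α .bruhat) ∧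
      -- right diagram
      (PQBG.SimpleBottom b J w γ α .quantum ↔ PQBG.SimpleTop b J w γ α .quantum) ∧
      -- the identity `r_α ⌊w r_γ⌋ = ⌊r_α w r_γ⌋` in both diagrams
      ((γ ≠ PQBG.act w⁻¹ α ∧ PQBG.SimpleBottom b J w γ α .bruhat) ∨
          PQBG.SimpleTop b J w γ α .bruhat ∨
          PQBG.SimpleBottom b J w γ α .quantum ∨ PQBG.SimpleTop b J w γ α .quantum →
        PQBG.refl P α * PQBG.floorRep b J (w * PQBG.refl P γ) =
          PQBG.floorRep b J (PQBG.refl P α * w * PQBG.refl P γ))) ∧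
    -- the diamonds for the highest root `θ`
    (∀ θ : ι, PQBG.IsHighestRoot b θ →
      ∀ z : P.weylGroup,
      PQBG.refl P θ * w = PQBG.floorRep b J (PQBG.refl P θ * w) * z →
      -- left diagram
      (P.pairing (PQBG.act w⁻¹ θ) γ ≠ 0 →
        (PQBG.ThetaBottom b J w γ θ .bruhat → PQBG.ThetaTop b J w γ θ z .quantum) ∧
        (γ ≠ PQBG.act w⁻¹ θ →
          PQBG.ThetaTop b J w γ θ z .quantum → PQBG.ThetaBottom b J w γ θ .bruhat)) ∧
      (P.pairing (PQBG.act w⁻¹ θ) γ = 0 →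
        (PQBG.ThetaBottom b J w γ θ .bruhat ↔ PQBG.ThetaTop b J w γ θ z .bruhat)) ∧
      -- right diagram
      (P.pairing (PQBG.act w⁻¹ θ) γ ≠ 0 →
        (γ ≠ PQBG.neg P (PQBG.act w⁻¹ θ) →
          PQBG.ThetaBottom b J w γ θ .quantum → PQBG.ThetaTop b J w γ θ z .bruhat) ∧
        (PQBG.ThetaTop b J w γ θ z .bruhat → PQBG.ThetaBottom b J w γ θ .quantum)) ∧
      (P.pairing (PQBG.act w⁻¹ θ) γ = 0 →
        (PQBG.ThetaBottom b J w γ θ .quantum ↔ PQBG.ThetaTop b J w γ θ z .quantum))) := by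
  have := Fintype.ofFinite ι
  rw [PQBG.mem_label_iff b hJ] at hγ
  refine ⟨fun α hα ↦ ⟨fun hne h ↦ h.top hJ hw hγ hα hne, fun hne h ↦ h.bottom hJ hw hγ hα hne,
    ⟨fun h ↦ h.top hJ hw hγ hα (h.ne_of_quantum hJ hw hγ hα),
      fun h ↦ h.bottom hJ hw hγ hα (h.ne_of_quantum hJ hγ hα)⟩, ?_⟩, fun θ hθ z hz ↦ ?_⟩
  · rintro (⟨hne, h⟩ | h | h | h)
    · exact (h.top hJ hw hγ hα hne).refl_mul_floorRep
    · exact h.refl_mul_floorRep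
    · exact (h.top hJ hw hγ hα (h.ne_of_quantum hJ hw hγ hα)).refl_mul_floorRep
    · exact h.refl_mul_floorRep
  -- The type shift is governed by the pairing in the opposite order; orthogonality is symmetric.
  · have hp : P.pairing (PQBG.act w⁻¹ θ) γ = 0 ↔ P.pairingIn ℤ γ (PQBG.act w⁻¹ θ) = 0 := by
      rw [P.pairing_eq_zero_iff', PQBG.pairing_eq_cast, Int.cast_eq_zero]
    rw [Ne, hp]
    refine ⟨fun h0 ↦ ⟨fun h ↦ ?_, fun hne h ↦ ?_⟩, fun h0 ↦ ⟨fun h ↦ ?_, fun h ↦ ?_⟩,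
      fun h0 ↦ ⟨fun hne h ↦ ?_, fun h ↦ ?_⟩, fun h0 ↦ ⟨fun h ↦ ?_, fun h ↦ ?_⟩⟩
    · exact h.top_of_iff hJ hw hγ hθ hz (h.ne_of_bruhat hJ hw hγ hθ) _ (by simp [h0])
    · exact h.bottom_of_iff hJ hw hγ hθ hz hne _ (by simp [h0])
    · exact h.top_of_iff hJ hw hγ hθ hz (h.ne_of_bruhat hJ hw hγ hθ) _ (by simp [h0])
    · exact h.bottom_of_iff hJ hw hγ hθ hz (h.ne_of_bruhat hJ hγ hθ hz) _ (by simp [h0])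
    · exact h.top_of_iff hJ hw hγ hθ hz hne _ (by simp [h0])
    · exact h.bottom_of_iff hJ hw hγ hθ hz (h.ne_of_bruhat hJ hγ hθ hz) _ (by simp [h0])
    · refine h.top_of_iff hJ hw hγ hθ hz ?_ _ (by simp [h0])
      -- For γ = -w⁻¹θ the pairing would be -2, not 0.
      rintro rfl
      simp [PQBG.pairingIn_neg_left] at h0
    · refine h.bottom_of_iff hJ hw hγ hθ hz ?_ _ (by simp [h0])
      rintro rfl
      simp at h0
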